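/- Von Neumann algebras act on a separable complex Hilbert space, von Neumann subalgebras contain the identity $I$ of the ambient algebra, and tracial states are faithful and normal. A von Neumann algebra is diffuse if it has no minimal projection. An irreducible subfactor of a type II$_1$ factor $\mathcal M$ is a factor $\mathcal M_1\subset\mathcal M$ with $\mathcal M_1'\cap\mathcal M=\mathbb C I$. For a von Neumann algebra $\mathcal A$ with tracial state $\tau$ and an integer $k\ge 1$, let $\mathfrak E_k$ be the collection of all families $\{p_j\}_{j=1}^k$ of mutually orthogonal projections of $\mathcal A$ with $\tau(p_j)=1/k$ for each $j$. For $x_1,\dots,x_n\in\mathcal A$ put $$\mathcal I(x_1,\dots,x_n;k)=\inf_{\{p_j\}\in\mathfrak E_k}\ \sum_{m=1}^n\frac{|\{(i,j)\mid p_i x_m p_j\neq 0\}|}{k^2},$$ $$\mathcal G(\mathcal A;k)=\inf\{\mathcal I(x_1,\dots,x_n;k)\mid n\in\mathbb N,\ x_1,\dots,x_n \text{ generate } \mathcal A \text{ as a von Neumann algebra}\},\qquad \mathcal G(\mathcal A)=\liminf_{k\to\infty}\mathcal G(\mathcal A;k),$$ where the infimum of the empty set is $\infty$ (so $\mathcal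 G(\mathcal A)=\infty$ if $\mathcal A$ is not finitely generated). **Proposition 5.1.** Let $\mathcal M$ be a type II$_1$ factor with the tracial state $\tau$. Let $\{\mathcal N_k\}_{k=1}^\infty$ be a sequence of von Neumann subalgebras of $\mathcal M$ that generates $\mathcal M$ as a von Neumann algebra, such that $\mathcal N_k\cap\mathcal N_{k+1}$ is diffuse for all $k\ge 1$. Suppose that for each $k\ge 1$ and each $\epsilon>0$ there is an irreducible subfactor $\mathcal M_{k,\epsilon}$ of $\mathcal M$ such that $\mathcal N_k\subset\mathcal M_{k,\epsilon}\subset\mathcal M$ and $\mathcal G(\mathcal M_{k,\epsilon})\le\epsilon$, where $\mathcal G(\mathcal M_{k,\epsilon})$ is computed with the restriction of $\tau$. Then $\mathcal G(\mathcal M)=0$. In particular, $\mathcal M$ is singly generated, that is, generated as a von Neumann algebra by one element (equivalently, by two self-adjoint elements). -/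

import Mathlib

open scoped ENNReal ComplexOrder InnerProductSpace

namespace VonNeumannAlgebra

variable {H : Type*} [NormedAddCommGroup H] [InnerProductSpace ℂ H] [CompleteSpace H]

/-- Scalar multiplication restricts to a von Neumann algebra; this gives `↥M` its structure of a
complex vector space. -/
instance instSMulMemClassComplex : SMulMemClass (VonNeumannAlgebra H) ℂ (H →L[ℂ] H) where
  smul_mem {S} c _ hx := S.toStarSubalgebra.smul_mem hx c

/-- The von Neumann algebra generated by a set `S` of operators: the double commutant of
`S ∪ S*` (`StarSubalgebra.centralizer ℂ S` is the commutant of `S ∪ S*`). -/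
noncomputable def generatedBy (S : Set (H →L[ℂ] H)) : VonNeumannAlgebra H where
  toStarSubalgebra :=
    StarSubalgebra.centralizer ℂ (StarSubalgebra.centralizer ℂ S : Set (H →L[ℂ] H))
  centralizer_centralizer' := by
    simp [StarSubalgebra.coe_centralizer]

/-- `generatedBy S` is the smallest von Neumann algebra containing `S`. -/
theorem generatedBy_le_iff {S : Set (H →L[ℂ] H)} {P : VonNeumannAlgebra H} :
    generatedBy S ≤ P ↔ S ⊆ (P : Set (H →L[ℂ] H)) := by
  have hcoe : (generatedBy S : Set (H →L[ℂ] H)) =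
      Set.centralizer (Set.centralizer (S ∪ star S)) := by
    have h : star (Set.centralizer (S ∪ star S)) = Set.centralizer (S ∪ star S) := by
      rw [← StarSubalgebra.coe_centralizer ℂ S]
      ext x
      simp only [Set.mem_star, SetLike.mem_coe, star_mem_iff]
    change ((StarSubalgebra.centralizer ℂ
      (StarSubalgebra.centralizer ℂ S : Set (H →L[ℂ] H)) :
        StarSubalgebra ℂ (H →L[ℂ] H)) : Set (H →L[ℂ] H)) = _
    rw [StarSubalgebra.coe_centralizer, StarSubalgebra.coe_centralizer, h, Set.union_self]
  rw [← SetLike.coe_subset_coe, hcoe]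
  constructor
  · exact fun h => (Set.subset_union_left.trans Set.subset_centralizer_centralizer).trans h
  · intro h
    rw [← P.centralizer_centralizer]
    refine Set.centralizer_subset (Set.centralizer_subset (Set.union_subset h ?_))
    intro x hx
    have := star_mem (h hx : star x ∈ P)
    rwa [star_star] at this

/-- The intersection of two von Neumann algebras. -/
noncomputable def inter (P Q : VonNeumannAlgebra H) : VonNeumannAlgebra H where
  toStarSubalgebra := P.toStarSubalgebra ⊓ Q.toStarSubalgebra
  centralizer_centralizer' := by
    change Set.centralizer (Set.centralizer ((P : Set (H →L[ℂ] H)) ∩ Q)) = (P : Set _) ∩ Q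
    refine Set.Subset.antisymm (Set.subset_inter ?_ ?_) Set.subset_centralizer_centralizer
    · conv_rhs => rw [← P.centralizer_centralizer]
      exact Set.centralizer_subset (Set.centralizer_subset Set.inter_subset_left)
    · conv_rhs => rw [← Q.centralizer_centralizer]
      exact Set.centralizer_subset (Set.centralizer_subset Set.inter_subset_right)

/-- A von Neumann algebra is diffuse if it has no minimal projection: every nonzero projection
`p` of `M` has a subprojection in `M` that is neither `0` nor `p`. -/
def IsDiffuse (M : VonNeumannAlgebra H) : Prop :=
  ∀ p ∈ M, IsStarProjection p → p ≠ 0 →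
    ∃ q ∈ M, IsStarProjection q ∧ p * q = q ∧ q ≠ 0 ∧ q ≠ p

/-- A factor: the center consists of the scalar multiples of the identity. -/
def IsFactor (M : VonNeumannAlgebra H) : Prop :=
  ∀ z ∈ M, (∀ y ∈ M, z * y = y * z) → ∃ c : ℂ, z = c • (1 : H →L[ℂ] H)

/-- `P` is an irreducible subfactor of `M`: a factor `P ⊆ M` with `P' ∩ M = ℂ I`. -/
structure IsIrreducibleSubfactor (P M : VonNeumannAlgebra H) : Prop where
  le : P ≤ M
  isFactor : P.IsFactor
  relativeCommutant : ∀ z ∈ M, (∀ y ∈ P, z * y = y * z) → ∃ c : ℂ, z = c • (1 : H →L[ℂ] H)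

/-- `τ` is a faithful normal tracial state of `M`. -/
structure IsTracialState (M : VonNeumannAlgebra H) (τ : M →ₗ[ℂ] ℂ) : Prop where
  map_one : τ 1 = 1
  nonneg : ∀ x : M, 0 ≤ τ (star x * x)
  tracial : ∀ x y : M, τ (x * y) = τ (y * x)
  faithful : ∀ x : M, τ (star x * x) = 0 → x = 0
  /-- Normality, as ultraweak continuity: `τ x = ∑ ⟪ξₙ, x ηₙ⟫` for two square-summable sequences
  of vectors. -/
  normal : ∃ ξ η : ℕ → H, Summable (fun n => ‖ξ n‖ ^ 2) ∧ Summable (fun n => ‖η n‖ ^ 2) ∧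
    ∀ x : M, HasSum (fun n => ⟪ξ n, (x : H →L[ℂ] H) (η n)⟫_ℂ) (τ x)

/-- A type II₁ factor: a factor without minimal projections that has a faithful normal tracial
state. -/
structure IsTypeIIOneFactor (M : VonNeumannAlgebra H) : Prop where
  isFactor : M.IsFactor
  isDiffuse : M.IsDiffuse
  exists_trace : ∃ τ : M →ₗ[ℂ] ℂ, M.IsTracialState τ

/-- The restriction of a linear functional on `M` to a von Neumann subalgebra `P ≤ M`. -/
noncomputable def restrict {P M : VonNeumannAlgebra H} (h : P ≤ M) (τ : M →ₗ[ℂ] ℂ) : P →ₗ[ℂ] ℂ where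
  toFun x := τ ⟨x, h x.2⟩
  map_add' x y := τ.map_add ⟨x, h x.2⟩ ⟨y, h y.2⟩
  map_smul' c x := τ.map_smul c ⟨x, h x.2⟩

/-- `p₁, …, p_k` is a family of mutually orthogonal projections of `M`, each of trace `1/k`. -/
structure IsEqualFamily (M : VonNeumannAlgebra H) (τ : M →ₗ[ℂ] ℂ) {k : ℕ} (p : Fin k → M) :
    Prop where
  isStarProjection : ∀ j, IsStarProjection (p j)
  orthogonal : ∀ i j, i ≠ j → p i * p j = 0
  trace_eq : ∀ j, τ (p j) = 1 / (k : ℂ)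

/-- `𝓘(x₁, …, xₙ; {p_j}) = ∑ₘ |{(i, j) | p_i xₘ p_j ≠ 0}| / k²`. -/
noncomputable def blockCount {M : VonNeumannAlgebra H} {n k : ℕ} (x : Fin n → M)
    (p : Fin k → M) : ℝ≥0∞ :=
  ∑ m, ({ij : Fin k × Fin k | p ij.1 * x m * p ij.2 ≠ 0}.ncard : ℝ≥0∞) / (k : ℝ≥0∞) ^ 2

/-- `𝓘(x₁, …, xₙ; k)`: the infimum of `𝓘(x₁, …, xₙ; {p_j})` over the families of `k` mutually
orthogonal projections of trace `1/k` in `M`. -/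
noncomputable def blockCountInf (M : VonNeumannAlgebra H) (τ : M →ₗ[ℂ] ℂ) {n : ℕ}
    (x : Fin n → M) (k : ℕ) : ℝ≥0∞ :=
  ⨅ (p : Fin k → M) (_ : M.IsEqualFamily τ p), blockCount x p

/-- `𝓖(M; k)`: the infimum of `𝓘(x₁, …, xₙ; k)` over all finite families of generators of `M`;
it is `∞` if `M` is not finitely generated, as the infimum of the empty set. -/
noncomputable def genCountAt (M : VonNeumannAlgebra H) (τ : M →ₗ[ℂ] ℂ) (k : ℕ) : ℝ≥0∞ :=
  ⨅ (n : ℕ) (x : Fin n → M)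
    (_ : generatedBy (Set.range fun i => (x i : H →L[ℂ] H)) = M), M.blockCountInf τ x k

/-- `𝓖(M) = liminf_{k → ∞} 𝓖(M; k)`. -/
noncomputable def genCount (M : VonNeumannAlgebra H) (τ : M →ₗ[ℂ] ℂ) : ℝ≥0∞ :=
  Filter.liminf (fun k => M.genCountAt τ k) Filter.atTop

/-- `M` is generated, as a von Neumann algebra, by one element. -/
def IsSinglyGenerated (M : VonNeumannAlgebra H) : Prop :=
  ∃ x : H →L[ℂ] H, generatedBy {x} = M

end VonNeumannAlgebra

/-!
The idea is that all but one of the infinitely many subfactors can be packed into a single operator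
of small support.

Choose an irreducible subfactor `P₀ ⊇ N 0` with small `𝓖(P₀)`, generators of `P₀` and an equal
partition of the identity in `P₀` for which few blocks of these generators are nonzero. It suffices
to find one operator `y = f y f`, with `f` a single projection of that partition, such that `P₀` and
`y` generate `M` (`exists_generating_operator`): the additional generator then costs one block.

To construct `y`, choose mutually orthogonal nonzero projections `g 0, g 1, …` of `P₀` under `f`,
and for each `k` an irreducible subfactor `P k ⊇ N (k + 1)` with `𝓖(P k)` small compared with the
square of the trace of `g k`. Let `Q k` be generated by `P₀` and `P i`, `i < k`. It lies between
`P₀` and `M`, so it is a factor by irreducibility of `P₀`. The diffuse algebra `N k ∩ N (k + 1)`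
lies in both `Q k` and `P k` and contains equal partitions of every size. Two equal partitions in
the factor `P k` are unitarily conjugate, so `P k` has generators with few nonzero blocks with
respect to a partition in `Q k`. Projections of equal trace in the factor `Q k` are equivalent, so
partial isometries of `Q k` move these blocks to distinct places and then under `g k`
(`exists_operator_under_projection`). The resulting operator `y k = g k (y k) g k` together with
`Q k` recovers `P k`. A norm convergent combination `y` of the `y k` recovers each of them as a
multiple of `g k y g k`, hence, by induction on `k`, all `P k`, and hence `M`.

The step from `𝓖(M) = 0` to one generator uses the same packing (`IsMatrixUnitRow.exists_packing`):
above the diagonal of a large equal partition there is room for a row of matrix units and all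
nonzero blocks, and the projections of the partition are the spectral projections of a second
self-adjoint operator.

The needed comparison theory (`IsTraceOn.exists_partialIsometry`,
`IsTraceOn.exists_projection_of_trace`) rests on strong limits of increasing sequences of partial
isometries (`exists_strong_limit`), polar decomposition and normality of the trace.
-/

open Filter Topology

namespace VonNeumannAlgebra

variable {H : Type*} [NormedAddCommGroup H] [InnerProductSpace ℂ H] [CompleteSpace H]

/-! ### Membership in von Neumann algebras and strong limits -/

theorem mem_of_forall_commute {M : VonNeumannAlgebra H} {x : H →L[ℂ] H}
    (h : ∀ y, (∀ z ∈ M, z * y = y * z) → y * x = x * y) : x ∈ M := by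
  rw [← M.commutant_commutant, mem_commutant_iff]
  intro y hy
  exact h y (mem_commutant_iff.1 hy)

theorem subset_generatedBy (S : Set (H →L[ℂ] H)) :
    S ⊆ (generatedBy S : Set (H →L[ℂ] H)) :=
  generatedBy_le_iff.1 le_rfl

theorem mem_generatedBy {S : Set (H →L[ℂ] H)} {x : H →L[ℂ] H} (hx : x ∈ S) :
    x ∈ generatedBy S := subset_generatedBy S hx

theorem generatedBy_eq_iff {S : Set (H →L[ℂ] H)} {M : VonNeumannAlgebra H}
    (hS : S ⊆ (M : Set (H →L[ℂ] H))) :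
    generatedBy S = M ↔
      ∀ R : VonNeumannAlgebra H, S ⊆ (R : Set (H →L[ℂ] H)) → M ≤ R := by
  constructor
  · rintro rfl R hR
    exact generatedBy_le_iff.2 hR
  · intro h
    exact le_antisymm (generatedBy_le_iff.2 hS) (h _ (subset_generatedBy S))

theorem inter_le_left (P Q : VonNeumannAlgebra H) : P.inter Q ≤ P := fun _ hx => hx.1

theorem inter_le_right (P Q : VonNeumannAlgebra H) : P.inter Q ≤ Q := fun _ hx => hx.2

theorem mem_of_tendsto {ι : Type*} {l : Filter ι} [l.NeBot] {M : VonNeumannAlgebra H}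
    {x : ι → H →L[ℂ] H} {a : H →L[ℂ] H}
    (hx : ∀ n, x n ∈ M) (h : ∀ ξ, Tendsto (fun n => x n ξ) l (𝓝 (a ξ))) : a ∈ M := by
  refine mem_of_forall_commute fun y hy => ?_
  ext ξ
  have h1 : Tendsto (fun n => y (x n ξ)) l (𝓝 (y (a ξ))) :=
    (y.continuous.tendsto _).comp (h ξ)
  have h2 : Tendsto (fun n => x n (y ξ)) l (𝓝 (a (y ξ))) := h _
  have h3 : (fun n => y (x n ξ)) = fun n => x n (y ξ) := by
    funext n
    exact congr($(hy _ (hx n)) ξ).symm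
  rw [h3] at h1
  exact tendsto_nhds_unique h1 h2

/-! ### Partial isometries and their extensions -/

/-- A partial isometry, in the algebraic form `v v* v = v`. -/
def IsPartialIsometry (v : H →L[ℂ] H) : Prop := v * star v * v = v

/-- `w` extends the partial isometry `v`: on the initial space of `v` the two agree, and likewise
for the adjoints. -/
structure Extends (v w : H →L[ℂ] H) : Prop where
  left : star w * v = star v * v
  right : w * star v = v * star v

theorem IsPartialIsometry.star {v : H →L[ℂ] H} (hv : IsPartialIsometry v) :
    IsPartialIsometry (star v) := by
  have := congr(Star.star $hv)
  simpa [IsPartialIsometry, mul_assoc] using this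

theorem IsPartialIsometry.isStarProjection {v : H →L[ℂ] H} (hv : IsPartialIsometry v) :
    IsStarProjection (Star.star v * v) where
  isIdempotentElem := by
    rw [IsIdempotentElem, mul_assoc, ← mul_assoc v, hv]
  isSelfAdjoint := by simp [IsSelfAdjoint]

theorem IsPartialIsometry.isStarProjection' {v : H →L[ℂ] H} (hv : IsPartialIsometry v) :
    IsStarProjection (v * Star.star v) := by
  simpa using hv.star.isStarProjection

theorem isPartialIsometry_of_isStarProjection {p : H →L[ℂ] H} (hp : IsStarProjection p) :
    IsPartialIsometry p := by
  rw [IsPartialIsometry, hp.isSelfAdjoint.star_eq, hp.isIdempotentElem.eq, hp.isIdempotentElem.eq]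

theorem isPartialIsometry_of_star_mul_self {v : H →L[ℂ] H} (h : IsStarProjection (star v * v)) :
    IsPartialIsometry v := by
  have h0 : star (v * star v * v - v) * (v * star v * v - v) = 0 := by
    have e := h.isIdempotentElem.eq
    have e1 : star v * (v * (star v * v)) = star v * v := by simpa [mul_assoc] using e
    simp only [star_sub, star_mul, star_star, sub_mul, mul_sub, mul_assoc, e1]
    simp
  have h1 := (CStarRing.star_mul_self_eq_zero_iff _).1 h0
  exact sub_eq_zero.1 h1

theorem norm_sq_apply_eq (v : H →L[ℂ] H) (ξ : H) :
    ‖v ξ‖ ^ 2 = (⟪(star v * v) ξ, ξ⟫_ℂ).re :=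
  v.apply_norm_sq_eq_inner_adjoint_left ξ

theorem norm_apply_eq_of_star_mul_self_eq {v w : H →L[ℂ] H} (h : star v * v = star w * w) (ξ : H) :
    ‖v ξ‖ = ‖w ξ‖ := by
  rw [← sq_eq_sq₀ (norm_nonneg _) (norm_nonneg _), norm_sq_apply_eq, norm_sq_apply_eq, h]

theorem IsPartialIsometry.norm_le {v : H →L[ℂ] H} (hv : IsPartialIsometry v) : ‖v‖ ≤ 1 := by
  have h1 : ‖v‖ * ‖v‖ = ‖Star.star v * v‖ := CStarRing.norm_star_mul_self.symm
  have h3 : ‖Star.star v * v‖ = ‖Star.star v * v‖ * ‖Star.star v * v‖ := by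
    have := CStarRing.norm_star_mul_self (x := Star.star v * v)
    rwa [hv.isStarProjection.isSelfAdjoint.star_eq, hv.isStarProjection.isIdempotentElem.eq] at this
  rw [← h1] at h3
  by_contra! hlt
  nlinarith [mul_pos (sub_pos.2 hlt) (sub_pos.2 hlt)]

namespace Extends

theorem refl (v : H →L[ℂ] H) : Extends v v := ⟨rfl, rfl⟩

theorem star {v w : H →L[ℂ] H} (h : Extends v w) : Extends (star v) (star w) :=
  ⟨by simpa using h.right, by simpa using h.left⟩

theorem trans {u v w : H →L[ℂ] H} (hu : IsPartialIsometry u)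
    (h₁ : Extends u v) (h₂ : Extends v w) : Extends u w := by
  have aux : ∀ {u v w : H →L[ℂ] H}, IsPartialIsometry u →
      Extends u v → Extends v w → Star.star w * u = Star.star u * u := by
    intro u v w hu h₁ h₂
    have e : u = v * (Star.star v * u) := by
      rw [h₁.left, ← mul_assoc, h₁.right, hu]
    calc Star.star w * u = (Star.star w * v) * (Star.star v * u) := by
          conv_lhs => rw [e]
          rw [mul_assoc]
      _ = Star.star v * (v * (Star.star v * u)) := by rw [h₂.left, mul_assoc]
      _ = Star.star u * u := by rw [← e, h₁.left]
  exact ⟨aux hu h₁ h₂, by simpa using aux hu.star h₁.star h₂.star⟩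

theorem norm_sub_sq {v w : H →L[ℂ] H} (h : Extends v w) (ξ : H) :
    ‖w ξ - v ξ‖ ^ 2 = ‖w ξ‖ ^ 2 - ‖v ξ‖ ^ 2 := by
  have h2 : Star.star v * w = Star.star v * v := by simpa using congr(Star.star $(h.left))
  have e : Star.star (w - v) * (w - v) = Star.star w * w - Star.star v * v := by
    rw [star_sub, sub_mul, mul_sub, mul_sub, h.left, h2]; abel
  have := norm_sq_apply_eq (w - v) ξ
  rw [e] at this
  rw [norm_sq_apply_eq w, norm_sq_apply_eq v, ← Complex.sub_re, ← inner_sub_left]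
  exact this

end Extends

theorem cauchySeq_apply_of_extends {v : ℕ → H →L[ℂ] H} (hv : ∀ n, IsPartialIsometry (v n))
    (hext : ∀ m n, m ≤ n → Extends (v m) (v n)) (ξ : H) : CauchySeq fun n => v n ξ := by
  have hmono : Monotone fun n => ‖v n ξ‖ ^ 2 := by
    intro m n hmn
    have := (hext m n hmn).norm_sub_sq ξ
    have h0 := sq_nonneg ‖v n ξ - v m ξ‖
    simp only
    linarith
  have hbdd : BddAbove (Set.range fun n => ‖v n ξ‖ ^ 2) := by
    refine ⟨‖ξ‖ ^ 2, ?_⟩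
    rintro _ ⟨n, rfl⟩
    have : ‖v n ξ‖ ≤ ‖ξ‖ := by
      simpa using (v n).le_of_opNorm_le (hv n).norm_le ξ
    simp only
    gcongr
  have hc := (tendsto_atTop_ciSup hmono hbdd).cauchySeq
  rw [Metric.cauchySeq_iff'] at hc ⊢
  intro ε hε
  obtain ⟨N, hN⟩ := hc (ε ^ 2) (by positivity)
  refine ⟨N, fun n hn => ?_⟩
  have h1 := hN n hn
  rw [dist_eq_norm] at h1 ⊢
  rw [← (hext N n hn).norm_sub_sq ξ, Real.norm_of_nonneg (sq_nonneg _)] at h1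
  exact lt_of_pow_lt_pow_left₀ 2 hε.le h1

/-- An increasing sequence of partial isometries converges strongly to a partial isometry that
extends all of them. -/
theorem exists_strong_limit {v : ℕ → H →L[ℂ] H} (hv : ∀ n, IsPartialIsometry (v n))
    (hext : ∀ m n, m ≤ n → Extends (v m) (v n)) :
    ∃ w : H →L[ℂ] H, IsPartialIsometry w ∧ (∀ n, Extends (v n) w) ∧
      ∀ ξ, Tendsto (fun n => v n ξ) atTop (𝓝 (w ξ)) := by
  have key : ∀ {v : ℕ → H →L[ℂ] H}, (∀ n, IsPartialIsometry (v n)) →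
      (∀ m n, m ≤ n → Extends (v m) (v n)) →
      ∃ w : H →L[ℂ] H, ∀ ξ, Tendsto (fun n => v n ξ) atTop (𝓝 (w ξ)) := by
    intro v hv hext
    choose g hg using fun ξ => cauchySeq_tendsto_of_complete (cauchySeq_apply_of_extends hv hext ξ)
    exact ⟨continuousLinearMapOfTendsto v (f := g) (tendsto_pi_nhds.2 hg), hg⟩
  obtain ⟨w, hw⟩ := key hv hext
  obtain ⟨w', hw'⟩ := key (fun n => (hv n).star) (fun m n h => (hext m n h).star)
  -- the strong limit of the adjoints is the adjoint of the limit, as the inner products show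
  have hww : w' = star w := by
    rw [ContinuousLinearMap.star_eq_adjoint, ContinuousLinearMap.eq_adjoint_iff]
    intro x y
    have h1 : Tendsto (fun n => ⟪star (v n) x, y⟫_ℂ) atTop (𝓝 ⟪w' x, y⟫_ℂ) :=
      (hw' x).inner tendsto_const_nhds
    have h2 : Tendsto (fun n => ⟪x, v n y⟫_ℂ) atTop (𝓝 ⟪x, w y⟫_ℂ) :=
      tendsto_const_nhds.inner (hw y)
    refine tendsto_nhds_unique h1 (h2.congr fun n => ?_)
    rw [ContinuousLinearMap.star_eq_adjoint, ContinuousLinearMap.adjoint_inner_left]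
  subst hww
  have hE : ∀ m, Extends (v m) w := by
    intro m
    constructor
    · ext ξ
      refine tendsto_nhds_unique (hw' (v m ξ)) (tendsto_const_nhds.congr' ?_)
      filter_upwards [eventually_ge_atTop m] with n hn
      exact congr($((hext m n hn).left) ξ).symm
    · ext ξ
      refine tendsto_nhds_unique (hw (star (v m) ξ)) (tendsto_const_nhds.congr' ?_)
      filter_upwards [eventually_ge_atTop m] with n hn
      exact congr($((hext m n hn).right) ξ).symm
  refine ⟨w, ?_, hE, hw⟩
  have h1 : ∀ m, w * star w * v m = v m := by
    intro m
    rw [mul_assoc, (hE m).left, ← mul_assoc, (hE m).right, hv m]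
  rw [IsPartialIsometry]
  ext ξ
  have h2 : Tendsto (fun n => (w * star w) (v n ξ)) atTop (𝓝 ((w * star w) (w ξ))) :=
    ((w * star w).continuous.tendsto _).comp (hw ξ)
  have h3 : (fun n => (w * star w) (v n ξ)) = fun n => v n ξ := by
    funext n
    exact congr($(h1 n) ξ)
  rw [h3] at h2
  exact tendsto_nhds_unique h2 (hw ξ)

/-- A greedy choice replaces Zorn's lemma: if increasing sequences for a transitive relation have
upper bounds and `f` is monotone and bounded, then there is an element at which `f` is maximal
among its successors. -/
theorem exists_forall_le_of_seq {α : Type*} {r : α → α → Prop} (hrefl : ∀ a, r a a)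
    (htrans : ∀ a b c, r a b → r b c → r a c) (f : α → ℝ) (hf : ∀ a b, r a b → f a ≤ f b)
    (hb : BddAbove (Set.range f))
    (hseq : ∀ a : ℕ → α, (∀ m n, m ≤ n → r (a m) (a n)) → ∃ b, ∀ n, r (a n) b)
    (a₀ : α) : ∃ m, ∀ c, r m c → f c ≤ f m := by
  have hstep : ∀ (n : ℕ) (a : α), ∃ b, r a b ∧ ∀ c, r a c → f c ≤ f b + 1 / ((n : ℝ) + 1) := by
    intro n a
    have hne : (f '' {c | r a c}).Nonempty := ⟨f a, a, hrefl a, rfl⟩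
    have hbd : BddAbove (f '' {c | r a c}) := hb.mono (Set.image_subset_range _ _)
    obtain ⟨_, ⟨b, hab, rfl⟩, hlt⟩ := exists_lt_of_lt_csSup hne
      (sub_lt_self (sSup (f '' {c | r a c})) (Nat.one_div_pos_of_nat (α := ℝ) (n := n)))
    refine ⟨b, hab, fun c hc => ?_⟩
    have := le_csSup hbd ⟨c, hc, rfl⟩
    linarith
  choose g hg1 hg2 using hstep
  let a : ℕ → α := fun n => Nat.rec a₀ (fun n x => g n x) n
  have ha : ∀ m n, m ≤ n → r (a m) (a n) := by
    intro m n hmn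
    induction n, hmn using Nat.le_induction with
    | base => exact hrefl _
    | succ n _ ih => exact htrans _ _ _ ih (hg1 n (a n))
  obtain ⟨b, hab⟩ := hseq a ha
  refine ⟨b, fun c hc => ?_⟩
  refine le_of_forall_pos_le_add fun ε hε => ?_
  obtain ⟨n, hn⟩ := exists_nat_one_div_lt hε
  have h1 : f c ≤ f (a (n + 1)) + 1 / ((n : ℝ) + 1) := hg2 n (a n) c (htrans _ _ _ (hab n) hc)
  have h2 := hf _ _ (hab (n + 1))
  linarith

/-! ### Polar decomposition and factors -/

/-- Polar decomposition inside a von Neumann algebra, in the form that comparison theory uses: a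
nonzero `x ∈ Q` yields a nonzero partial isometry of `Q` whose support and range lie inside
those of `x`. -/
theorem exists_partialIsometry_of_ne_zero {Q : VonNeumannAlgebra H} {x : H →L[ℂ] H} (hx : x ∈ Q)
    (hx0 : x ≠ 0) : ∃ u ∈ Q, IsPartialIsometry u ∧ u ≠ 0 ∧
      (∀ q : H →L[ℂ] H, q * x = x → q * u = u) ∧
      ∀ p : H →L[ℂ] H, IsStarProjection p → x * p = x → u * p = u := by
  set a : H →L[ℂ] H := CFC.sqrt (star x * x) with ha
  have ha_nonneg : 0 ≤ a := CFC.sqrt_nonneg _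
  have ha_sa : star a = a := ha_nonneg.isSelfAdjoint.star_eq
  have ha_sq : star a * a = star x * x := by
    rw [ha_sa, ha, CFC.sqrt_mul_sqrt_self _ (star_mul_self_nonneg x)]
  have hnorm : ∀ ξ, ‖x ξ‖ = ‖a ξ‖ := fun ξ => norm_apply_eq_of_star_mul_self_eq ha_sq.symm ξ
  have ha_comm : ∀ y : H →L[ℂ] H, (∀ z ∈ Q, z * y = y * z) → y * a = a * y := by
    intro y hy
    have h1 : Commute (star x * x) y := hy _ (mul_mem (star_mem hx) hx)
    exact (h1.cfcₙ_nnreal _).eq.symm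
  let K : Submodule ℂ H := (LinearMap.range a.toLinearMap).topologicalClosure
  have hmem : ∀ ξ, a ξ ∈ K := fun ξ =>
    Submodule.le_topologicalClosure _ (LinearMap.mem_range_self a.toLinearMap ξ)
  let e : H →ₗ[ℂ] K := a.toLinearMap.codRestrict K hmem
  have he : DenseRange e := by
    intro k
    rw [closure_subtype]
    have hk : (k : H) ∈ closure (Set.range a) := k.2
    convert hk
    ext ζ
    constructor
    · rintro ⟨_, ⟨ξ, rfl⟩, rfl⟩
      exact ⟨ξ, rfl⟩
    · rintro ⟨ξ, rfl⟩
      exact ⟨e ξ, ⟨ξ, rfl⟩, rfl⟩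
  have hb : ∀ ξ, ‖x ξ‖ ≤ 1 * ‖e ξ‖ := fun ξ => by
    rw [one_mul, hnorm ξ]; rfl
  let g : K →L[ℂ] H := x.toLinearMap.extendOfNorm e
  have hg : ∀ ξ, g (e ξ) = x ξ := fun ξ =>
    LinearMap.extendOfNorm_eq he ⟨1, hb⟩ ξ
  have hgn : ∀ k : K, ‖g k‖ = ‖k‖ := by
    intro k
    refine he.induction_on (p := fun k => ‖g k‖ = ‖k‖) k
      (isClosed_eq (g.continuous.norm) continuous_norm) fun ξ => ?_
    rw [hg, hnorm]; rfl
  have : CompleteSpace K := (Submodule.isClosed_topologicalClosure _).completeSpace_coe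
  let u : H →L[ℂ] H := g ∘L K.orthogonalProjectionOnto
  have hua : ∀ ξ, u (a ξ) = x ξ := by
    intro ξ
    have : K.orthogonalProjectionOnto (a ξ) = e ξ :=
      Submodule.orthogonalProjectionOnto_mem_subspace_eq_self (K := K) (e ξ)
    change g (K.orthogonalProjectionOnto (a ξ)) = x ξ
    rw [this, hg]
  have hP : IsStarProjection K.starProjection := isStarProjection_starProjection
  have huP : star u * u = K.starProjection := by
    have hn : ∀ ξ, ‖u ξ‖ = ‖K.starProjection ξ‖ := fun ξ => hgn _
    have hPP : K.starProjection = star K.starProjection * K.starProjection := by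
      rw [hP.isSelfAdjoint.star_eq, hP.isIdempotentElem.eq]
    apply ContinuousLinearMap.coe_injective
    rw [← ext_inner_map]
    intro ξ
    conv_rhs => rw [hPP]
    change ⟪(star u) (u ξ), ξ⟫_ℂ = ⟪(star K.starProjection) (K.starProjection ξ), ξ⟫_ℂ
    rw [ContinuousLinearMap.star_eq_adjoint, ContinuousLinearMap.adjoint_inner_left,
      ContinuousLinearMap.star_eq_adjoint, ContinuousLinearMap.adjoint_inner_left,
      inner_self_eq_norm_sq_to_K, inner_self_eq_norm_sq_to_K, hn]
  have huPu : u * K.starProjection = u := by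
    ext ξ
    exact congrArg g (Submodule.orthogonalProjectionOnto_mem_subspace_eq_self
      (K.orthogonalProjectionOnto ξ))
  have ext_of : ∀ {b c : H →L[ℂ] H}, b * a = c * a →
      b * K.starProjection = c * K.starProjection := by
    intro b c h
    have hcl : K ≤ LinearMap.eqLocus b.toLinearMap c.toLinearMap := by
      refine Submodule.topologicalClosure_minimal _ ?_ (isClosed_eq b.continuous c.continuous)
      rintro _ ⟨ξ, rfl⟩
      exact congr($h ξ)
    ext ξ
    exact hcl (K.starProjection_apply_mem ξ)
  have hux : u * a = x := by ext ξ; exact hua ξ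
  have hPQ : ∀ y : H →L[ℂ] H, (∀ z ∈ Q, z * y = y * z) →
      K.starProjection * y = y * K.starProjection := by
    intro y hy
    have h1 : K.starProjection ∈ Q := by
      rw [IsStarProjection.mem_iff hP]
      intro y hy
      rw [Submodule.range_starProjection]
      have hy' := ha_comm y (mem_commutant_iff.1 hy)
      have := Submodule.topologicalClosure_minimal (LinearMap.range a.toLinearMap)
        (t := K.comap y.toLinearMap) (by
          rintro _ ⟨ξ, rfl⟩
          have := hmem (y ξ)
          rw [show a (y ξ) = y (a ξ) from congr($hy' ξ).symm] at this
          exact this)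
        ((Submodule.isClosed_topologicalClosure _).preimage y.continuous)
      exact this
    exact hy _ h1
  refine ⟨u, ?_, isPartialIsometry_of_star_mul_self (huP ▸ hP), ?_, ?_, ?_⟩
  · refine mem_of_forall_commute fun y hy => ?_
    have h1 : (y * u) * a = (u * y) * a := by
      rw [mul_assoc, hux, mul_assoc, ha_comm y hy, ← mul_assoc, hux, hy x hx]
    have h2 := ext_of h1
    rwa [mul_assoc, huPu, mul_assoc, ← hPQ y hy, ← mul_assoc, huPu] at h2
  · intro h0
    rw [h0, zero_mul] at hux
    exact hx0 hux.symm
  · intro q hq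
    have h1 : (q * u) * a = u * a := by rw [mul_assoc, hux, hq]
    have h2 := ext_of h1
    rwa [mul_assoc, huPu] at h2
  · intro p hp hxp
    have h1 : a * (1 - p) = 0 := by
      ext ξ
      have h2 : x ((1 - p) ξ) = 0 := by
        have : x * (1 - p) = 0 := by rw [mul_sub, mul_one, hxp, sub_self]
        exact congr($this ξ)
      have h3 := hnorm ((1 - p) ξ)
      rw [h2, norm_zero] at h3
      exact norm_eq_zero.1 h3.symm
    have h2 : (1 - p) * a = 0 := by
      have := congr(star $h1)
      simpa [ha_sa, hp.isSelfAdjoint.star_eq] using this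
    have h3 : (1 - p) * K.starProjection = 0 := by
      simpa using ext_of (c := 0) (by simpa using h2)
    have h4 : K.starProjection * (1 - p) = 0 := by
      have := congr(star $h3)
      simpa [hP.isSelfAdjoint.star_eq, hp.isSelfAdjoint.star_eq] using this
    have h5 : u * (1 - p) = 0 := by rw [← huPu, mul_assoc, h4, mul_zero]
    rw [mul_sub, mul_one, sub_eq_zero] at h5
    exact h5.symm

/-- In a factor, two nonzero projections are linked by a nonzero corner `p Q q`. -/
theorem IsFactor.exists_mul_mul_ne_zero {Q : VonNeumannAlgebra H} (hQ : Q.IsFactor)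
    {p q : H →L[ℂ] H} (hp : p ≠ 0) (hqQ : q ∈ Q) (hq : q ≠ 0) :
    ∃ x ∈ Q, p * x * q ≠ 0 := by
  by_contra! hcon
  -- `K` is the closed span of `Q q H`; its projection is central.
  let S : Set H := {ζ | ∃ x ∈ Q, ∃ ξ, ζ = x (q ξ)}
  let K : Submodule ℂ H := (Submodule.span ℂ S).topologicalClosure
  have : CompleteSpace K := (Submodule.isClosed_topologicalClosure _).completeSpace_coe
  have hSK : ∀ x ∈ Q, ∀ ξ, x (q ξ) ∈ K := fun x hx ξ =>
    Submodule.le_topologicalClosure _ (Submodule.subset_span ⟨x, hx, ξ, rfl⟩)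
  have hK : ∀ {L : Submodule ℂ H}, IsClosed (L : Set H) → (∀ x ∈ Q, ∀ ξ, x (q ξ) ∈ L) → K ≤ L := by
    intro L hL h
    refine Submodule.topologicalClosure_minimal _ (Submodule.span_le.2 ?_) hL
    rintro _ ⟨x, hx, ξ, rfl⟩
    exact h x hx ξ
  have hz : IsStarProjection K.starProjection := isStarProjection_starProjection
  have hinv : ∀ y : H →L[ℂ] H, (∀ x ∈ Q, ∀ ξ, y (x (q ξ)) ∈ K) →
      K ∈ Module.End.invtSubmodule y.toLinearMap := by
    intro y hy
    have := hK (L := K.comap y.toLinearMap)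
      ((Submodule.isClosed_topologicalClosure _).preimage y.continuous) hy
    exact this
  have hzQ : K.starProjection ∈ Q := by
    rw [IsStarProjection.mem_iff hz]
    intro y hy
    rw [Submodule.range_starProjection]
    refine hinv y fun x hx ξ => ?_
    rw [mem_commutant_iff] at hy
    have h1 : y (x (q ξ)) = x (q (y ξ)) := by
      have e1 : x (y (q ξ)) = y (x (q ξ)) := congr($(hy x hx) (q ξ))
      have e2 : q (y ξ) = y (q ξ) := congr($(hy q hqQ) ξ)
      rw [← e1, ← e2]
    rw [h1]
    exact hSK x hx _
  have hzQ' : K.starProjection ∈ Q.commutant := by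
    rw [IsStarProjection.mem_iff hz]
    intro y hy
    rw [Submodule.range_starProjection]
    rw [commutant_commutant] at hy
    exact hinv y fun x hx ξ => hSK (y * x) (mul_mem hy hx) ξ
  obtain ⟨c, hc⟩ := hQ _ hzQ fun y hy => (mem_commutant_iff.1 hzQ' y hy).symm
  have hzq : K.starProjection * q = q := by
    ext ξ
    exact Submodule.starProjection_eq_self_iff.2 (by simpa using hSK 1 (one_mem Q) ξ)
  have hpz : p * K.starProjection = 0 := by
    ext ξ
    have := hK (L := LinearMap.ker p.toLinearMap) p.isClosed_ker (fun x hx ξ => by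
      exact congr($(hcon x hx) ξ))
    exact this (K.starProjection_apply_mem ξ)
  rw [hc] at hzq hpz
  simp only [smul_mul_assoc, one_mul, mul_smul_comm, mul_one, smul_eq_zero] at hzq hpz
  rcases hpz with h | h
  · rw [h, zero_smul] at hzq
    exact hq hzq.symm
  · exact hp h

/-! ### Traces -/

/-- A linear functional `φ` on all bounded operators whose restriction to `M` is a faithful normal
tracial state. Unlike a functional on the subtype `M`, it restricts to the subalgebras of `M` with
no change of type. Normality is stated as continuity along strongly convergent sequences in the
unit ball. -/
structure IsTraceOn (M : VonNeumannAlgebra H) (φ : (H →L[ℂ] H) →ₗ[ℂ] ℂ) : Prop where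
  map_one : φ 1 = 1
  nonneg : ∀ x ∈ M, 0 ≤ φ (star x * x)
  tracial : ∀ x ∈ M, ∀ y ∈ M, φ (x * y) = φ (y * x)
  faithful : ∀ x ∈ M, φ (star x * x) = 0 → x = 0
  normal : ∀ (x : ℕ → H →L[ℂ] H) (a : H →L[ℂ] H), (∀ n, ‖x n‖ ≤ 1) →
    (∀ ξ, Tendsto (fun n => x n ξ) atTop (𝓝 (a ξ))) →
    Tendsto (fun n => φ (x n)) atTop (𝓝 (φ a))

theorem IsTraceOn.mono {P M : VonNeumannAlgebra H} {φ : (H →L[ℂ] H) →ₗ[ℂ] ℂ} (h : M.IsTraceOn φ)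
    (hPM : P ≤ M) : P.IsTraceOn φ where
  map_one := h.map_one
  nonneg x hx := h.nonneg x (hPM hx)
  tracial x hx y hy := h.tracial x (hPM hx) y (hPM hy)
  faithful x hx := h.faithful x (hPM hx)
  normal := h.normal

/-- A normal functional extends to all bounded operators through its defining vectors. -/
theorem IsTracialState.exists_isTraceOn {M : VonNeumannAlgebra H} {τ : M →ₗ[ℂ] ℂ}
    (hτ : M.IsTracialState τ) :
    ∃ φ : (H →L[ℂ] H) →ₗ[ℂ] ℂ, M.IsTraceOn φ ∧ ∀ x : M, τ x = φ x := by
  obtain ⟨ξ, η, hξ, hη, hsum⟩ := hτ.normal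
  have hbd : Summable fun n => (‖ξ n‖ ^ 2 + ‖η n‖ ^ 2) := hξ.add hη
  have hle : ∀ (x : H →L[ℂ] H) (n : ℕ),
      ‖⟪ξ n, x (η n)⟫_ℂ‖ ≤ ‖x‖ * (‖ξ n‖ ^ 2 + ‖η n‖ ^ 2) := by
    intro x n
    have h1 := norm_inner_le_norm (𝕜 := ℂ) (ξ n) (x (η n))
    have h2 := x.le_opNorm (η n)
    have h3 : ‖ξ n‖ * ‖x (η n)‖ ≤ ‖ξ n‖ * (‖x‖ * ‖η n‖) := by gcongr
    have h4 : ‖ξ n‖ * ‖η n‖ ≤ ‖ξ n‖ ^ 2 + ‖η n‖ ^ 2 := by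
      nlinarith [sq_nonneg (‖ξ n‖ - ‖η n‖), sq_nonneg ‖ξ n‖, sq_nonneg ‖η n‖]
    have h5 := mul_le_mul_of_nonneg_left h4 (norm_nonneg x)
    linarith
  have hs : ∀ x : H →L[ℂ] H, Summable fun n => ⟪ξ n, x (η n)⟫_ℂ := fun x =>
    Summable.of_norm_bounded (hbd.mul_left ‖x‖) (hle x)
  let φ : (H →L[ℂ] H) →ₗ[ℂ] ℂ :=
    { toFun := fun x => ∑' n, ⟪ξ n, x (η n)⟫_ℂ
      map_add' := fun x y => by
        rw [← (hs x).tsum_add (hs y)]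
        simp
      map_smul' := fun c x => by
        simp [tsum_mul_left] }
  have hφ : ∀ x : M, τ x = φ x := fun x => (hsum x).tsum_eq.symm
  refine ⟨φ, ⟨?_, ?_, ?_, ?_, ?_⟩, hφ⟩
  · rw [← hτ.map_one, hφ]; rfl
  · intro x hx
    have := hτ.nonneg ⟨x, hx⟩
    rwa [hφ] at this
  · intro x hx y hy
    have := hτ.tracial ⟨x, hx⟩ ⟨y, hy⟩
    rwa [hφ, hφ] at this
  · intro x hx h0
    have := hτ.faithful ⟨x, hx⟩ (by rw [hφ]; exact h0)
    exact congrArg Subtype.val this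
  · intro x a hx hxa
    refine tendsto_tsum_of_dominated_convergence hbd (fun n => ?_) (Eventually.of_forall ?_)
    · exact tendsto_const_nhds.inner (hxa (η n))
    · intro m n
      refine (hle (x m) n).trans ?_
      have : 0 ≤ ‖ξ n‖ ^ 2 + ‖η n‖ ^ 2 := by positivity
      nlinarith [hx m]

/-- `f ≤ e` for projections, written as `e f = f`, also gives `f e = f`. -/
theorem mul_eq_of_isStarProjection {e f : H →L[ℂ] H} (he : IsStarProjection e)
    (hf : IsStarProjection f) (h : e * f = f) : f * e = f := by
  have := congr(star $h)
  rwa [star_mul, he.isSelfAdjoint.star_eq, hf.isSelfAdjoint.star_eq] at this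

namespace IsTraceOn

variable {M : VonNeumannAlgebra H} {φ : (H →L[ℂ] H) →ₗ[ℂ] ℂ}

theorem apply_nonneg (hφ : M.IsTraceOn φ) {p : H →L[ℂ] H} (hp : p ∈ M) (h : IsStarProjection p) :
    0 ≤ φ p := by
  have := hφ.nonneg p hp
  rwa [h.isSelfAdjoint.star_eq, h.isIdempotentElem.eq] at this

theorem re_nonneg (hφ : M.IsTraceOn φ) {p : H →L[ℂ] H} (hp : p ∈ M) (h : IsStarProjection p) :
    0 ≤ (φ p).re := (Complex.nonneg_iff.1 (hφ.apply_nonneg hp h)).1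

theorem apply_eq_re (hφ : M.IsTraceOn φ) {p : H →L[ℂ] H} (hp : p ∈ M) (h : IsStarProjection p) :
    φ p = ((φ p).re : ℂ) := by
  apply Complex.ext
  · simp
  · simpa using (Complex.nonneg_iff.1 (hφ.apply_nonneg hp h)).2.symm

theorem eq_zero_of_re_le (hφ : M.IsTraceOn φ) {p : H →L[ℂ] H} (hp : p ∈ M)
    (h : IsStarProjection p) (h0 : (φ p).re ≤ 0) : p = 0 := by
  apply hφ.faithful p hp
  rw [h.isSelfAdjoint.star_eq, h.isIdempotentElem.eq, hφ.apply_eq_re hp h,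
    le_antisymm h0 (hφ.re_nonneg hp h), Complex.ofReal_zero]

theorem re_pos (hφ : M.IsTraceOn φ) {p : H →L[ℂ] H} (hp : p ∈ M)
    (h : IsStarProjection p) (h0 : p ≠ 0) : 0 < (φ p).re := by
  by_contra! hle
  exact h0 (hφ.eq_zero_of_re_le hp h hle)

theorem re_mono (hφ : M.IsTraceOn φ) {e f : H →L[ℂ] H} (heM : e ∈ M) (hfM : f ∈ M)
    (he : IsStarProjection e) (hf : IsStarProjection f) (h : e * f = f) :
    (φ f).re ≤ (φ e).re := by
  have := hφ.re_nonneg (sub_mem heM hfM) (hf.sub_of_mul_eq_right he h)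
  rw [map_sub, Complex.sub_re] at this
  linarith

theorem eq_of_re_le (hφ : M.IsTraceOn φ) {e f : H →L[ℂ] H} (heM : e ∈ M) (hfM : f ∈ M)
    (he : IsStarProjection e) (hf : IsStarProjection f) (h : e * f = f)
    (hle : (φ e).re ≤ (φ f).re) : f = e := by
  have := hφ.eq_zero_of_re_le (sub_mem heM hfM) (hf.sub_of_mul_eq_right he h)
    (by rw [map_sub, Complex.sub_re]; linarith)
  exact (sub_eq_zero.1 this).symm

/-! ### Comparison of projections in a finite factor -/

/-- In a factor with a trace, projections are compared by their traces. A maximal partial isometry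
from `p` to `q` exists; if it missed part of both, a nonzero corner between the two
remainders would extend it. -/
theorem exists_partialIsometry (hφ : M.IsTraceOn φ) (hM : M.IsFactor) {p q : H →L[ℂ] H}
    (hpM : p ∈ M) (hqM : q ∈ M) (hp : IsStarProjection p) (hq : IsStarProjection q)
    (hpq : (φ p).re ≤ (φ q).re) : ∃ v ∈ M, star v * v = p ∧ q * v = v := by
  let α := {v : H →L[ℂ] H // v ∈ M ∧ IsPartialIsometry v ∧ q * v = v ∧ v * p = v}
  have hproj : ∀ v : α, p * (star v.1 * v.1) = star v.1 * v.1 := by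
    intro v
    have := congr(star $(v.2.2.2.2))
    rw [star_mul, hp.isSelfAdjoint.star_eq] at this
    rw [← mul_assoc, this]
  have hinit : ∀ v : α, star v.1 * v.1 ∈ M := fun v => mul_mem (star_mem v.2.1) v.2.1
  have hmono : ∀ v w : α, Extends v.1 w.1 →
      (φ (star v.1 * v.1)).re ≤ (φ (star w.1 * w.1)).re := by
    intro v w hvw
    refine hφ.re_mono (hinit w) (hinit v) w.2.2.1.isStarProjection v.2.2.1.isStarProjection ?_
    have h2 : star v.1 * w.1 = star v.1 * v.1 := by simpa using congr(star $(hvw.left))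
    have h3 : w.1 * (star v.1 * v.1) = v.1 := by
      rw [← mul_assoc, hvw.right, v.2.2.1]
    rw [mul_assoc, h3, hvw.left]
  have hbdd : BddAbove (Set.range fun v : α => (φ (star v.1 * v.1)).re) := by
    refine ⟨(φ p).re, ?_⟩
    rintro _ ⟨v, rfl⟩
    exact hφ.re_mono hpM (hinit v) hp v.2.2.1.isStarProjection (hproj v)
  have hseq : ∀ a : ℕ → α, (∀ m n, m ≤ n → Extends (a m).1 (a n).1) →
      ∃ b : α, ∀ n, Extends (a n).1 b.1 := by
    intro a ha
    obtain ⟨w, hw, hext, hlim⟩ := exists_strong_limit (v := fun n => (a n).1)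
      (fun n => (a n).2.2.1) ha
    refine ⟨⟨w, mem_of_tendsto (fun n => (a n).2.1) hlim, hw, ?_, ?_⟩, hext⟩
    · ext ξ
      refine tendsto_nhds_unique ((q.continuous.tendsto _).comp (hlim ξ)) ((hlim ξ).congr ?_)
      intro n
      exact congr($((a n).2.2.2.1) ξ).symm
    · ext ξ
      refine tendsto_nhds_unique (hlim (p ξ)) ((hlim ξ).congr ?_)
      intro n
      exact congr($((a n).2.2.2.2) ξ).symm
  obtain ⟨⟨v, hvM, hv, hqv, hvp⟩, hmax⟩ := exists_forall_le_of_seq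
    (r := fun v w : α => Extends v.1 w.1) (fun v => .refl v.1)
    (fun u v w h₁ h₂ => Extends.trans u.2.2.1 h₁ h₂) _ hmono hbdd hseq
    ⟨0, zero_mem _, by simp [IsPartialIsometry], by simp, by simp⟩
  have hpv : p * (star v * v) = star v * v := hproj ⟨v, hvM, hv, hqv, hvp⟩
  have hqv' : q * (v * star v) = v * star v := by rw [← mul_assoc, hqv]
  have hp₀ : IsStarProjection (p - star v * v) := hv.isStarProjection.sub_of_mul_eq_right hp hpv
  have hq₀ : IsStarProjection (q - v * star v) := hv.isStarProjection'.sub_of_mul_eq_right hq hqv'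
  have hsvM := star_mem hvM
  have hp₀M : p - star v * v ∈ M := sub_mem hpM (mul_mem hsvM hvM)
  have hq₀M : q - v * star v ∈ M := sub_mem hqM (mul_mem hvM hsvM)
  refine ⟨v, hvM, ?_, hqv⟩
  by_contra hne
  have hp₀0 : p - star v * v ≠ 0 := fun h => hne (sub_eq_zero.1 h).symm
  have hq₀0 : q - v * star v ≠ 0 := by
    intro h
    apply hp₀0
    apply hφ.eq_zero_of_re_le hp₀M hp₀
    have h1 := congrArg φ (sub_eq_zero.1 h)
    rw [hφ.tracial v hvM _ hsvM] at h1
    rw [map_sub, Complex.sub_re, ← h1]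
    linarith
  obtain ⟨x, hxM, hx⟩ := hM.exists_mul_mul_ne_zero hq₀0 hp₀M hp₀0
  obtain ⟨u, huM, hu, hu0, hul, hur⟩ := exists_partialIsometry_of_ne_zero
    (mul_mem (mul_mem hq₀M hxM) hp₀M) hx
  have hqu : (q - v * star v) * u = u := hul _ (by
    rw [← mul_assoc, ← mul_assoc, hq₀.isIdempotentElem.eq])
  have hup : u * (p - star v * v) = u := hur _ hp₀ (by
    rw [mul_assoc, hp₀.isIdempotentElem.eq])
  have hsu : (p - star v * v) * star u = star u := by
    have := congr(star $hup)
    rwa [star_mul, hp₀.isSelfAdjoint.star_eq] at this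
  have hv' : star v * v * star v = star v := by simpa [IsPartialIsometry] using hv.star
  have hqsv : star v * q = star v := by
    have := congr(star $hqv)
    rwa [star_mul, hq.isSelfAdjoint.star_eq] at this
  have h1 : star v * u = 0 := by
    rw [← hqu, ← mul_assoc, mul_sub, hqsv, ← mul_assoc, hv', sub_self, zero_mul]
  have h1' : star u * v = 0 := by simpa using congr(star $h1)
  have h2 : v * star u = 0 := by
    rw [← hsu, ← mul_assoc, mul_sub, hvp, ← mul_assoc, hv, sub_self, zero_mul]
  have h2' : u * star v = 0 := by simpa using congr(star $h2)
  have hsum : star (v + u) * (v + u) = star v * v + star u * u := by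
    rw [star_add, add_mul, mul_add, mul_add, h1, h1']; abel
  have hpi : IsPartialIsometry (v + u) := by
    apply isPartialIsometry_of_star_mul_self
    rw [hsum]
    refine hv.isStarProjection.add hu.isStarProjection ?_
    rw [mul_assoc, ← mul_assoc v, h2, zero_mul, mul_zero]
  have hlt := hmax ⟨v + u, add_mem hvM huM, hpi, ?_, ?_⟩ ⟨?_, ?_⟩
  · simp only [hsum, map_add, Complex.add_re] at hlt
    have := hφ.eq_zero_of_re_le (mul_mem (star_mem huM) huM) hu.isStarProjection (by linarith)
    exact hu0 ((CStarRing.star_mul_self_eq_zero_iff _).1 this)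
  · rw [mul_add, hqv]
    conv_lhs => rw [← hqu]
    rw [← mul_assoc, mul_sub, hq.isIdempotentElem.eq, hqv', hqu]
  · rw [add_mul, hvp]
    have := mul_eq_of_isStarProjection hp hv.isStarProjection hpv
    conv_lhs => rw [← hup]
    rw [mul_assoc, sub_mul, hp.isIdempotentElem.eq, this, hup]
  · simp only
    rw [star_add, add_mul, h1', add_zero]
  · simp only
    rw [add_mul, h2', add_zero]

/-- Projections of equal trace in a factor are Murray–von Neumann equivalent. -/
theorem exists_equiv (hφ : M.IsTraceOn φ) (hM : M.IsFactor) {p q : H →L[ℂ] H}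
    (hpM : p ∈ M) (hqM : q ∈ M) (hp : IsStarProjection p) (hq : IsStarProjection q)
    (hpq : φ p = φ q) : ∃ v ∈ M, star v * v = p ∧ v * star v = q := by
  obtain ⟨v, hvM, hvp, hqv⟩ := hφ.exists_partialIsometry hM hpM hqM hp hq (by rw [hpq])
  refine ⟨v, hvM, hvp, ?_⟩
  have hv := isPartialIsometry_of_star_mul_self (hvp ▸ hp)
  refine hφ.eq_of_re_le hqM (mul_mem hvM (star_mem hvM)) hq hv.isStarProjection' ?_ ?_
  · rw [← mul_assoc, hqv]
  · rw [hφ.tracial v hvM _ (star_mem hvM), hvp, hpq]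

/-! ### Projections of prescribed trace in a diffuse algebra -/

/-- Repeated splitting gives subprojections of small trace: one of the two parts has at most half
of it. -/
theorem exists_small (φ : (H →L[ℂ] H) →ₗ[ℂ] ℂ) (hM : M.IsDiffuse) {e : H →L[ℂ] H}
    (heM : e ∈ M) (he : IsStarProjection e) (he0 : e ≠ 0) {δ : ℝ} (hδ : 0 < δ) :
    ∃ f ∈ M, IsStarProjection f ∧ e * f = f ∧ f ≠ 0 ∧ (φ f).re < δ := by
  have key : ∀ n : ℕ, ∃ f ∈ M, IsStarProjection f ∧ e * f = f ∧ f ≠ 0 ∧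
      (φ f).re ≤ (φ e).re * (1 / 2) ^ n := by
    intro n
    induction n with
    | zero => exact ⟨e, heM, he, he.isIdempotentElem.eq, he0, by simp⟩
    | succ n ih =>
      obtain ⟨f, hfM, hf, hef, hf0, hle⟩ := ih
      obtain ⟨q, hqM, hq, hfq, hq0, hqf⟩ := hM f hfM hf hf0
      rw [pow_succ]
      rcases le_total (φ q).re ((φ f).re / 2) with h | h
      · refine ⟨q, hqM, hq, ?_, hq0, by linarith⟩
        rw [← hfq, ← mul_assoc, hef]
      · refine ⟨f - q, sub_mem hfM hqM, hq.sub_of_mul_eq_right hf hfq, ?_,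
          fun h0 => hqf (sub_eq_zero.1 h0).symm, ?_⟩
        · rw [mul_sub, hef, ← hfq, ← mul_assoc, hef]
        · rw [map_sub, Complex.sub_re]; linarith
  have hlim : Tendsto (fun n : ℕ => (φ e).re * (1 / 2 : ℝ) ^ n) atTop (𝓝 0) := by
    simpa using (tendsto_pow_atTop_nhds_zero_of_lt_one (by norm_num : (0 : ℝ) ≤ 1 / 2)
      (by norm_num)).const_mul (φ e).re
  obtain ⟨n, hn⟩ := (hlim.eventually_lt_const hδ).exists
  obtain ⟨f, hfM, hf, hef, hf0, hle⟩ := key n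
  exact ⟨f, hfM, hf, hef, hf0, hle.trans_lt hn⟩

/-- A diffuse algebra has projections of every trace below a given projection: a subprojection that
is maximal among those of trace at most `t` has trace `t`, since otherwise a projection of small
trace could be added. Normality keeps limits within the trace bound. -/
theorem exists_projection_of_trace (hφ : M.IsTraceOn φ) (hM : M.IsDiffuse) {e : H →L[ℂ] H}
    (heM : e ∈ M) (he : IsStarProjection e) {t : ℝ} (ht : 0 ≤ t) (hte : t ≤ (φ e).re) :
    ∃ f ∈ M, IsStarProjection f ∧ e * f = f ∧ φ f = t := by
  let α := {f : H →L[ℂ] H // f ∈ M ∧ IsStarProjection f ∧ e * f = f ∧ (φ f).re ≤ t}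
  have hle_iff : ∀ f g : α, Extends f.1 g.1 → g.1 * f.1 = f.1 := by
    intro f g h
    have := h.left
    rwa [f.2.2.1.isSelfAdjoint.star_eq, g.2.2.1.isSelfAdjoint.star_eq,
      f.2.2.1.isIdempotentElem.eq] at this
  have hmono : ∀ f g : α, Extends f.1 g.1 → (φ f.1).re ≤ (φ g.1).re := fun f g h =>
    hφ.re_mono g.2.1 f.2.1 g.2.2.1 f.2.2.1 (hle_iff f g h)
  have hbdd : BddAbove (Set.range fun f : α => (φ f.1).re) := by
    refine ⟨t, ?_⟩
    rintro _ ⟨f, rfl⟩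
    exact f.2.2.2.2
  have hseq : ∀ a : ℕ → α, (∀ m n, m ≤ n → Extends (a m).1 (a n).1) →
      ∃ b : α, ∀ n, Extends (a n).1 b.1 := by
    intro a ha
    have hpi : ∀ n, IsPartialIsometry (a n).1 :=
      fun n => isPartialIsometry_of_isStarProjection (a n).2.2.1
    obtain ⟨w, hw, hext, hlim⟩ := exists_strong_limit (v := fun n => (a n).1)
      hpi ha
    -- the limit is a partial isometry with `w* w = w`, hence a projection
    have hww : star w * w = w := by
      ext ξ
      refine tendsto_nhds_unique (((star w).continuous.tendsto _).comp (hlim ξ))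
        ((hlim ξ).congr ?_)
      intro n
      have := (hext n).left
      rw [(a n).2.2.1.isSelfAdjoint.star_eq, (a n).2.2.1.isIdempotentElem.eq] at this
      exact congr($this ξ).symm
    have hwp : IsStarProjection w := hww ▸ hw.isStarProjection
    refine ⟨⟨w, mem_of_tendsto (fun n => (a n).2.1) hlim, hwp, ?_, ?_⟩, hext⟩
    · ext ξ
      refine tendsto_nhds_unique ((e.continuous.tendsto _).comp (hlim ξ)) ((hlim ξ).congr ?_)
      intro n
      exact congr($((a n).2.2.2.1) ξ).symm
    · have h1 := hφ.normal _ w (fun n => (hpi n).norm_le) hlim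
      have h2 := (Complex.continuous_re.tendsto _).comp h1
      exact le_of_tendsto' h2 fun n => (a n).2.2.2.2
  obtain ⟨⟨m, hmM, hm, hem, hmt⟩, hmax⟩ := exists_forall_le_of_seq
    (r := fun v w : α => Extends v.1 w.1) (fun v => .refl v.1)
    (fun u v w h₁ h₂ => Extends.trans (isPartialIsometry_of_isStarProjection u.2.2.1) h₁ h₂)
    _ hmono hbdd hseq
    ⟨0, zero_mem _, .zero _, by simp, by simpa using ht⟩
  refine ⟨m, hmM, hm, hem, ?_⟩
  rw [hφ.apply_eq_re hmM hm, Complex.ofReal_inj]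
  by_contra hne
  have hlt : (φ m).re < t := lt_of_le_of_ne hmt hne
  have hme := mul_eq_of_isStarProjection he hm hem
  have hd : IsStarProjection (e - m) := hm.sub_of_mul_eq_right he hem
  obtain ⟨f, hfM, hf, hdf, hf0, hfδ⟩ := exists_small φ hM (sub_mem heM hmM) hd
    (fun h => by
      have := congrArg (fun x => (φ x).re) h
      simp only [map_sub, Complex.sub_re, map_zero, Complex.zero_re] at this
      linarith) (sub_pos.2 hlt)
  have hmf : m * f = 0 := by
    rw [← hdf, ← mul_assoc, mul_sub, hme, hm.isIdempotentElem.eq, sub_self, zero_mul]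
  have hfm : f * m = 0 := by
    have := congr(star $hmf)
    rwa [star_mul, hm.isSelfAdjoint.star_eq, hf.isSelfAdjoint.star_eq, star_zero] at this
  have hef : e * f = f := by
    rw [sub_mul, hmf, sub_zero] at hdf
    exact hdf
  have hmf' : IsStarProjection (m + f) := hm.add hf hmf
  have hlast := hmax ⟨m + f, add_mem hmM hfM, hmf', by rw [mul_add, hem, hef], by
    rw [map_add, Complex.add_re]; linarith⟩ ⟨by
      simp only
      rw [hmf'.isSelfAdjoint.star_eq, hm.isSelfAdjoint.star_eq, add_mul, hfm, add_zero], by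
      simp only
      rw [hm.isSelfAdjoint.star_eq, add_mul, hfm, add_zero]⟩
  simp only [map_add, Complex.add_re] at hlast
  linarith [hφ.re_pos hfM hf hf0]

/-- Diffuseness passes from a subalgebra to a factor that contains it: every projection of the
factor dominates a copy of a projection of the subalgebra with half its trace. -/
theorem isDiffuse_of_le (hφ : M.IsTraceOn φ) (hM : M.IsFactor) {D : VonNeumannAlgebra H}
    (hD : D.IsDiffuse) (hDM : D ≤ M) : M.IsDiffuse := by
  intro p hpM hp hp0
  have hpos := hφ.re_pos hpM hp hp0
  have hp1 : (φ p).re ≤ (φ 1).re := hφ.re_mono (one_mem _) hpM (.one _) hp (one_mul p)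
  obtain ⟨g, hgD, hg, -, hgt⟩ := (hφ.mono hDM).exists_projection_of_trace hD (one_mem D) (.one _)
    (t := (φ p).re / 2) (by linarith) (by linarith)
  obtain ⟨v, hvM, hvg, hpv⟩ := hφ.exists_partialIsometry hM (hDM hgD) hpM hg hp
    (by rw [hgt, Complex.ofReal_re]; linarith)
  have hv := isPartialIsometry_of_star_mul_self (hvg ▸ hg)
  have htr : φ (v * star v) = ((φ p).re / 2 : ℝ) := by
    rw [hφ.tracial v hvM _ (star_mem hvM), hvg, hgt]
  refine ⟨v * star v, mul_mem hvM (star_mem hvM), hv.isStarProjection', ?_, ?_, ?_⟩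
  · rw [← mul_assoc, hpv]
  · intro h
    rw [h, map_zero] at htr
    have := congrArg Complex.re htr
    simp only [Complex.zero_re, Complex.ofReal_re] at this
    linarith
  · intro h
    rw [h] at htr
    have := congrArg Complex.re htr
    simp only [Complex.ofReal_re] at this
    linarith

end IsTraceOn

/-- Below a nonzero projection of a diffuse algebra there is an infinite orthogonal sequence of
nonzero projections. -/
theorem IsDiffuse.exists_orthogonal_seq {M : VonNeumannAlgebra H} (hM : M.IsDiffuse)
    {e : H →L[ℂ] H} (heM : e ∈ M) (he : IsStarProjection e) (he0 : e ≠ 0) :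
    ∃ f : ℕ → H →L[ℂ] H, (∀ n, f n ∈ M) ∧ (∀ n, IsStarProjection (f n)) ∧ (∀ n, f n ≠ 0) ∧
      (∀ n, e * f n = f n) ∧ ∀ m n, m ≠ n → f m * f n = 0 := by
  let α := {p : H →L[ℂ] H // p ∈ M ∧ IsStarProjection p ∧ p ≠ 0}
  have hstep : ∀ p : α, ∃ q : α, p.1 * q.1 = q.1 ∧ q.1 ≠ p.1 := by
    rintro ⟨p, hpM, hp, hp0⟩
    obtain ⟨q, hqM, hq, h1, h2, h3⟩ := hM p hpM hp hp0
    exact ⟨⟨q, hqM, hq, h2⟩, h1, h3⟩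
  choose g hg1 hg2 using hstep
  let a : ℕ → α := fun n => Nat.rec ⟨e, heM, he, he0⟩ (fun _ x => g x) n
  have hsucc : ∀ n, (a n).1 * (a (n + 1)).1 = (a (n + 1)).1 := fun n => hg1 (a n)
  have hle : ∀ m n, m ≤ n → (a m).1 * (a n).1 = (a n).1 := by
    intro m n hmn
    induction n, hmn using Nat.le_induction with
    | base => exact (a m).2.2.1.isIdempotentElem.eq
    | succ n _ ih => rw [← hsucc n, ← mul_assoc, ih]
  have hf : ∀ n, IsStarProjection ((a n).1 - (a (n + 1)).1) := fun n =>
    (a (n + 1)).2.2.1.sub_of_mul_eq_right (a n).2.2.1 (hsucc n)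
  have hlt : ∀ m n, m < n →
      ((a m).1 - (a (m + 1)).1) * ((a n).1 - (a (n + 1)).1) = 0 := by
    intro m n hmn
    simp only [sub_mul, mul_sub, hle m n hmn.le, hle m (n + 1) (by omega), hle (m + 1) n hmn,
      hle (m + 1) (n + 1) (by omega)]
    abel
  refine ⟨fun n => (a n).1 - (a (n + 1)).1, fun n => sub_mem (a n).2.1 (a (n + 1)).2.1, hf,
    fun n h => hg2 (a n) (sub_eq_zero.1 h).symm, fun n => ?_, fun m n hmn => ?_⟩
  · have h1 : e * (a n).1 = (a n).1 := hle 0 n (Nat.zero_le n)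
    have h2 : e * (a (n + 1)).1 = (a (n + 1)).1 := hle 0 (n + 1) (Nat.zero_le _)
    simp only [mul_sub, h1, h2]
  · rcases lt_or_gt_of_ne hmn with h | h
    · exact hlt m n h
    · have := congr(star $(hlt n m h))
      rwa [star_mul, (hf n).isSelfAdjoint.star_eq, (hf m).isSelfAdjoint.star_eq, star_zero] at this

/-! ### Equal partitions and block counts -/

/-- A family of `K` mutually orthogonal projections of `M` with `φ`-trace `1 / K`, as operators
rather than as elements of the subtype `M`. -/
structure IsEqualPartition (M : VonNeumannAlgebra H) (φ : (H →L[ℂ] H) →ₗ[ℂ] ℂ) {K : ℕ}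
    (p : Fin K → H →L[ℂ] H) : Prop where
  mem : ∀ j, p j ∈ M
  isStarProjection : ∀ j, IsStarProjection (p j)
  orthogonal : ∀ i j, i ≠ j → p i * p j = 0
  trace_eq : ∀ j, φ (p j) = 1 / (K : ℂ)

theorem isStarProjection_sum {ι : Type*} (s : Finset ι) {p : ι → H →L[ℂ] H}
    (hp : ∀ j, IsStarProjection (p j)) (ho : ∀ i j, i ≠ j → p i * p j = 0) :
    IsStarProjection (∑ j ∈ s, p j) where
  isIdempotentElem := by
    classical
    rw [IsIdempotentElem, Finset.sum_mul]
    refine Finset.sum_congr rfl fun i hi => ?_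
    rw [Finset.mul_sum, Finset.sum_eq_single i (fun j _ hj => ho i j hj.symm)
      (fun h => absurd hi h), (hp i).isIdempotentElem.eq]
  isSelfAdjoint := by
    rw [IsSelfAdjoint, star_sum]
    exact Finset.sum_congr rfl fun i _ => (hp i).isSelfAdjoint.star_eq

namespace IsEqualPartition

variable {M P : VonNeumannAlgebra H} {φ : (H →L[ℂ] H) →ₗ[ℂ] ℂ} {K : ℕ} {p : Fin K → H →L[ℂ] H}

theorem mono (hp : P.IsEqualPartition φ p) (hPM : P ≤ M) : M.IsEqualPartition φ p :=
  ⟨fun j => hPM (hp.mem j), hp.isStarProjection, hp.orthogonal, hp.trace_eq⟩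

theorem sum_eq_one (hp : M.IsEqualPartition φ p) (hφ : M.IsTraceOn φ) (hK : K ≠ 0) :
    ∑ j, p j = 1 := by
  have hs := isStarProjection_sum Finset.univ hp.isStarProjection hp.orthogonal
  refine hφ.eq_of_re_le (one_mem M) (sum_mem fun j _ => hp.mem j) (.one _) hs (one_mul _) ?_
  have : (K : ℂ) ≠ 0 := Nat.cast_ne_zero.2 hK
  rw [map_sum, Finset.sum_congr rfl fun j _ => hp.trace_eq j]
  simp [hφ.map_one, this]

end IsEqualPartition

theorem IsTraceOn.exists_orthogonal_of_trace {D : VonNeumannAlgebra H}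
    {φ : (H →L[ℂ] H) →ₗ[ℂ] ℂ} (hφ : D.IsTraceOn φ) (hD : D.IsDiffuse) {t : ℝ} (ht : 0 ≤ t)
    (n : ℕ) : ∀ e ∈ D, IsStarProjection e → n * t ≤ (φ e).re →
      ∃ p : Fin n → H →L[ℂ] H, (∀ j, p j ∈ D) ∧ (∀ j, IsStarProjection (p j)) ∧
        (∀ j, e * p j = p j) ∧ (∀ i j, i ≠ j → p i * p j = 0) ∧ ∀ j, φ (p j) = t := by
  induction n with
  | zero => exact fun e _ _ _ => ⟨fun _ => 0, by simp⟩
  | succ n ih =>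
    intro e heD he hle
    push_cast at hle
    have hnt : 0 ≤ n * t := by positivity
    obtain ⟨f, hfD, hf, hef, hft⟩ := hφ.exists_projection_of_trace hD heD he ht (by linarith)
    have hfe := mul_eq_of_isStarProjection he hf hef
    obtain ⟨p, hpD, hp, hep, ho, hpt⟩ := ih (e - f) (sub_mem heD hfD)
      (hf.sub_of_mul_eq_right he hef) (by
        rw [map_sub, Complex.sub_re, hft, Complex.ofReal_re]; linarith)
    have hfp : ∀ j, f * p j = 0 := fun j => by
      rw [← hep j, ← mul_assoc, mul_sub, hfe, hf.isIdempotentElem.eq, sub_self, zero_mul]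
    have hpf : ∀ j, p j * f = 0 := fun j => by
      have := congr(star $(hfp j))
      rwa [star_mul, hf.isSelfAdjoint.star_eq, (hp j).isSelfAdjoint.star_eq, star_zero] at this
    refine ⟨Fin.cons f p, ?_, ?_, ?_, ?_, ?_⟩
    · exact Fin.cases hfD hpD
    · exact Fin.cases hf hp
    · refine Fin.cases hef fun j => ?_
      have := hep j
      rw [sub_mul, hfp j, sub_zero] at this
      exact this
    · refine Fin.cases (Fin.cases (fun h => absurd rfl h) fun j _ => hfp j) fun i =>
        Fin.cases (fun _ => hpf i) fun j hij => ho i j fun h => hij (h ▸ rfl)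
    · exact Fin.cases hft hpt

theorem IsTraceOn.exists_isEqualPartition {D : VonNeumannAlgebra H}
    {φ : (H →L[ℂ] H) →ₗ[ℂ] ℂ} (hφ : D.IsTraceOn φ) (hD : D.IsDiffuse) {K : ℕ} (hK : K ≠ 0) :
    ∃ p : Fin K → H →L[ℂ] H, D.IsEqualPartition φ p := by
  have hK' : (K : ℝ) ≠ 0 := Nat.cast_ne_zero.2 hK
  obtain ⟨p, hpD, hp, -, ho, ht⟩ := hφ.exists_orthogonal_of_trace hD
    (t := 1 / (K : ℝ)) (by positivity) K 1 (one_mem D) (.one _) (by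
      rw [hφ.map_one, Complex.one_re, mul_one_div_cancel hK'])
  exact ⟨p, hpD, hp, ho, fun j => by rw [ht j]; push_cast; rfl⟩

/-- A value of `𝓖(P; K)` below `c` is witnessed by generators, an equal partition and a set `T` of
at most `c K²` indices that contains those of all nonzero blocks. -/
theorem exists_of_genCountAt_lt {P : VonNeumannAlgebra H} {τ : P →ₗ[ℂ] ℂ}
    {φ : (H →L[ℂ] H) →ₗ[ℂ] ℂ} (hτφ : ∀ x : P, τ x = φ x) {K : ℕ} (hK : K ≠ 0) {c : ℝ}
    (h : P.genCountAt τ K < ENNReal.ofReal c) :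
    ∃ (n : ℕ) (x : Fin n → H →L[ℂ] H) (p : Fin K → H →L[ℂ] H)
      (T : Finset (Fin n × Fin K × Fin K)),
      generatedBy (Set.range x) = P ∧ P.IsEqualPartition φ p ∧
      (∀ m i j, p i * x m * p j ≠ 0 → (m, i, j) ∈ T) ∧ (T.card : ℝ) ≤ c * (K : ℝ) ^ 2 := by
  classical
  simp only [genCountAt, blockCountInf, iInf_lt_iff] at h
  obtain ⟨n, x, hx, p, hp, hlt⟩ := h
  have hblock : ∀ (m : Fin n) (i j : Fin K), p i * x m * p j ≠ 0 ↔
      (p i : H →L[ℂ] H) * x m * p j ≠ 0 := by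
    intro m i j
    rw [ne_eq, ne_eq, ← Subtype.coe_inj]
    rfl
  let T : Finset (Fin n × Fin K × Fin K) :=
    Finset.univ.filter fun t => p t.2.1 * x t.1 * p t.2.2 ≠ 0
  refine ⟨n, fun m => x m, fun j => p j, T, hx, ⟨fun j => (p j).2, fun j => ?_, fun i j hij => ?_,
    fun j => ?_⟩, fun m i j hne => ?_, ?_⟩
  · have h1 := hp.isStarProjection j
    exact ⟨congrArg Subtype.val h1.isIdempotentElem.eq,
      congrArg Subtype.val h1.isSelfAdjoint.star_eq⟩
  · exact congrArg Subtype.val (hp.orthogonal i j hij)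
  · rw [← hτφ, hp.trace_eq]
  · simpa [T] using (hblock m i j).2 hne
  · have hcard : ∀ m, {ij : Fin K × Fin K | p ij.1 * x m * p ij.2 ≠ 0}.ncard =
        (T.filter fun t => t.1 = m).card := by
      intro m
      rw [Set.ncard_eq_toFinset_card', ← Finset.card_map ⟨fun ij : Fin K × Fin K => (m, ij),
        fun a b hab => (Prod.ext_iff.1 hab).2⟩]
      congr 1
      ext ⟨m', i, j⟩
      simp only [Finset.mem_map, Set.mem_toFinset, Set.mem_ofPred_eq, T, Finset.mem_filter,
        Finset.mem_univ, true_and]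
      constructor
      · rintro ⟨⟨i', j'⟩, hne, h⟩
        obtain ⟨rfl, h⟩ := Prod.ext_iff.1 h
        obtain ⟨rfl, rfl⟩ := Prod.ext_iff.1 h
        exact ⟨hne, rfl⟩
      · rintro ⟨hne, rfl⟩
        exact ⟨(i, j), hne, rfl⟩
    have hTcard : T.card = ∑ m, {ij : Fin K × Fin K | p ij.1 * x m * p ij.2 ≠ 0}.ncard := by
      rw [Finset.card_eq_sum_card_fiberwise (f := Prod.fst) (t := Finset.univ)
        (fun _ _ => Finset.mem_coe.2 (Finset.mem_univ _))]
      exact Finset.sum_congr rfl fun m _ => (hcard m).symm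
    have hbc : blockCount x p = (T.card : ℝ≥0∞) / (K : ℝ≥0∞) ^ 2 := by
      rw [hTcard, blockCount]
      push_cast
      simp only [div_eq_mul_inv, Finset.sum_mul]
    rw [hbc] at hlt
    have hKpos : (0 : ℝ) < (K : ℝ) ^ 2 := by positivity
    have h1 : (T.card : ℝ≥0∞) / (K : ℝ≥0∞) ^ 2 = ENNReal.ofReal (T.card / (K : ℝ) ^ 2) := by
      rw [ENNReal.ofReal_div_of_pos hKpos, ENNReal.ofReal_natCast,
        ENNReal.ofReal_pow (by positivity), ENNReal.ofReal_natCast]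
    rw [h1] at hlt
    have h2 := ((ENNReal.ofReal_lt_ofReal_iff_of_nonneg (by positivity)).1 hlt).le
    rwa [div_le_iff₀ hKpos] at h2

theorem genCountAt_le {M : VonNeumannAlgebra H} {τ : M →ₗ[ℂ] ℂ}
    {φ : (H →L[ℂ] H) →ₗ[ℂ] ℂ} (hτφ : ∀ x : M, τ x = φ x) {n K : ℕ}
    {x : Fin n → H →L[ℂ] H} {p : Fin K → H →L[ℂ] H} {T : Finset (Fin n × Fin K × Fin K)}
    (hx : generatedBy (Set.range x) = M) (hp : M.IsEqualPartition φ p)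
    (hT : ∀ m i j, p i * x m * p j ≠ 0 → (m, i, j) ∈ T) :
    M.genCountAt τ K ≤ (T.card : ℝ≥0∞) / (K : ℝ≥0∞) ^ 2 := by
  classical
  have hxM : ∀ m, x m ∈ M := fun m => hx ▸ mem_generatedBy (Set.mem_range_self m)
  let x' : Fin n → M := fun m => ⟨x m, hxM m⟩
  let p' : Fin K → M := fun j => ⟨p j, hp.mem j⟩
  have hp' : M.IsEqualFamily τ p' := by
    refine ⟨fun j => ?_, fun i j hij => Subtype.ext (hp.orthogonal i j hij), fun j => ?_⟩
    · exact ⟨Subtype.ext (hp.isStarProjection j).isIdempotentElem.eq,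
        Subtype.ext (hp.isStarProjection j).isSelfAdjoint.star_eq⟩
    · rw [hτφ]; exact hp.trace_eq j
  have hle : ∀ m, {ij : Fin K × Fin K | p' ij.1 * x' m * p' ij.2 ≠ 0}.ncard ≤
      (T.filter fun t => t.1 = m).card := by
    intro m
    rw [← Set.ncard_coe_finset]
    refine Set.ncard_le_ncard_of_injOn (fun ij => (m, ij)) ?_ ?_ (Finset.finite_toSet _)
    · rintro ⟨i, j⟩ hij
      have : p i * x m * p j ≠ 0 := fun h => hij (Subtype.ext h)
      simpa using hT m i j this
    · intro a _ b _ hab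
      exact (Prod.ext_iff.1 hab).2
  calc M.genCountAt τ K ≤ blockCount x' p' := by
        refine (iInf_le_of_le n (iInf_le_of_le x' (iInf_le_of_le hx ?_)))
        exact iInf_le_of_le p' (iInf_le_of_le hp' le_rfl)
    _ = ((∑ m, {ij : Fin K × Fin K | p' ij.1 * x' m * p' ij.2 ≠ 0}.ncard : ℕ) : ℝ≥0∞) /
          (K : ℝ≥0∞) ^ 2 := by
        rw [blockCount]
        push_cast
        simp only [div_eq_mul_inv, Finset.sum_mul]
    _ ≤ (T.card : ℝ≥0∞) / (K : ℝ≥0∞) ^ 2 := by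
        gcongr
        rw [Finset.card_eq_sum_card_fiberwise (s := T) (f := Prod.fst) (t := Finset.univ)
          (fun _ _ => Finset.mem_coe.2 (Finset.mem_univ _))]
        exact Finset.sum_le_sum fun m _ => hle m

/-! ### Packing blocks -/

/-- `v` is the row `o` of a system of matrix units with the diagonal projections `p`. -/
structure IsMatrixUnitRow {K : ℕ} (p v : Fin K → H →L[ℂ] H) (o : Fin K) : Prop where
  isStarProjection : ∀ j, IsStarProjection (p j)
  orthogonal : ∀ i j, i ≠ j → p i * p j = 0
  sum_eq_one : ∑ j, p j = 1
  initial : ∀ j, star (v j) * v j = p j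
  final : ∀ j, v j * star (v j) = p o
  diagonal : v o = p o

theorem IsEqualPartition.exists_isMatrixUnitRow {M : VonNeumannAlgebra H}
    {φ : (H →L[ℂ] H) →ₗ[ℂ] ℂ} {K : ℕ} {p : Fin K → H →L[ℂ] H} (hp : M.IsEqualPartition φ p)
    (hφ : M.IsTraceOn φ) (hM : M.IsFactor) (o : Fin K) :
    ∃ v : Fin K → H →L[ℂ] H, (∀ j, v j ∈ M) ∧ IsMatrixUnitRow p v o := by
  have h : ∀ j, ∃ v ∈ M, star v * v = p j ∧ v * star v = p o ∧ (j = o → v = p o) := by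
    intro j
    by_cases hj : j = o
    · subst hj
      have e1 := (hp.isStarProjection j).isSelfAdjoint.star_eq
      have e2 := (hp.isStarProjection j).isIdempotentElem.eq
      exact ⟨p j, hp.mem j, by rw [e1, e2], by rw [e1, e2], fun _ => rfl⟩
    · obtain ⟨v, hvM, h1, h2⟩ := hφ.exists_equiv hM (hp.mem j) (hp.mem o) (hp.isStarProjection j)
        (hp.isStarProjection o) (by rw [hp.trace_eq, hp.trace_eq])
      exact ⟨v, hvM, h1, h2, fun h => absurd h hj⟩
  choose v hvM h1 h2 h3 using h
  exact ⟨v, hvM, hp.isStarProjection, hp.orthogonal, hp.sum_eq_one hφ (Nat.ne_of_gt o.pos),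
    h1, h2, h3 o rfl⟩

namespace IsMatrixUnitRow

variable {K : ℕ} {p v : Fin K → H →L[ℂ] H} {o : Fin K}

theorem isPartialIsometry (h : IsMatrixUnitRow p v o) (j : Fin K) : IsPartialIsometry (v j) :=
  isPartialIsometry_of_star_mul_self (h.initial j ▸ h.isStarProjection j)

theorem mul_proj (h : IsMatrixUnitRow p v o) (j : Fin K) : v j * p j = v j := by
  rw [← h.initial, ← mul_assoc, h.isPartialIsometry j]

theorem proj_mul (h : IsMatrixUnitRow p v o) (j : Fin K) : p o * v j = v j := by
  rw [← h.final j, h.isPartialIsometry j]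

theorem mul_proj_of_ne (h : IsMatrixUnitRow p v o) {i j : Fin K} (hij : i ≠ j) :
    v i * p j = 0 := by
  rw [← h.mul_proj i, mul_assoc, h.orthogonal i j hij, mul_zero]

theorem proj_mul_of_ne (h : IsMatrixUnitRow p v o) {i j : Fin K} (hi : i ≠ o) :
    p i * v j = 0 := by
  rw [← h.proj_mul j, ← mul_assoc, h.orthogonal i o hi, zero_mul]

theorem proj_mul_star (h : IsMatrixUnitRow p v o) (j : Fin K) : p j * star (v j) = star (v j) := by
  have := congr(star $(h.mul_proj j))
  rwa [star_mul, (h.isStarProjection j).isSelfAdjoint.star_eq] at this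

theorem proj_mul_star_of_ne (h : IsMatrixUnitRow p v o) {i j : Fin K} (hij : i ≠ j) :
    p j * star (v i) = 0 := by
  have := congr(star $(h.mul_proj_of_ne hij))
  rwa [star_mul, (h.isStarProjection j).isSelfAdjoint.star_eq, star_zero] at this

theorem eq_sum_blocks (h : IsMatrixUnitRow p v o) (x : H →L[ℂ] H) :
    x = ∑ i, ∑ j, p i * x * p j := by
  conv_lhs => rw [← one_mul x, ← mul_one (1 * x), ← h.sum_eq_one]
  rw [Finset.mul_sum, Finset.sum_comm]
  simp_rw [Finset.sum_mul]

/-- Packing: the nonzero blocks of several operators, indexed by `T`, are moved by matrix units to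
distinct places `σ t` of one operator `y`. The matrix units move them back, so they
and the blocks of `y` recover the operators. -/
theorem exists_packing (h : IsMatrixUnitRow p v o) {M : VonNeumannAlgebra H}
    (hv : ∀ j, v j ∈ M) {n : ℕ} {x : Fin n → H →L[ℂ] H} (hx : ∀ m, x m ∈ M)
    {T : Finset (Fin n × Fin K × Fin K)} (hT : ∀ m i j, p i * x m * p j ≠ 0 → (m, i, j) ∈ T)
    {σ : T → Fin K × Fin K} (hσ : Function.Injective σ) :
    ∃ y ∈ M, (∀ r l, (∀ t, σ t ≠ (r, l)) → p r * y * p l = 0) ∧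
      ∀ R : VonNeumannAlgebra H, (∀ j, v j ∈ R) →
        (∀ t, p (σ t).1 * y * p (σ t).2 ∈ R) → ∀ m, x m ∈ R := by
  let b : T → H →L[ℂ] H := fun t =>
    star (v (σ t).1) * (v t.1.2.1 * x t.1.1 * star (v t.1.2.2)) * v (σ t).2
  have hb : ∀ t, p (σ t).1 * b t * p (σ t).2 = b t := by
    intro t
    simp only [b]
    rw [← mul_assoc, ← mul_assoc, h.proj_mul_star, mul_assoc _ (v _) (p _), h.mul_proj]
  have hb0 : ∀ t r l, σ t ≠ (r, l) → p r * b t * p l = 0 := by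
    intro t r l hne
    by_cases h1 : (σ t).1 = r
    · have h2 : (σ t).2 ≠ l := fun h2 => hne (Prod.ext h1 h2)
      simp only [b]
      rw [mul_assoc, mul_assoc _ (v _) (p _), h.mul_proj_of_ne h2, mul_zero, mul_zero]
    · simp only [b]
      rw [← mul_assoc, ← mul_assoc, h.proj_mul_star_of_ne h1, zero_mul, zero_mul, zero_mul]
  have hsum : ∀ r l, p r * (∑ t, b t) * p l = ∑ t, p r * b t * p l := by
    intro r l
    rw [Finset.mul_sum, Finset.sum_mul]
  refine ⟨∑ t, b t, sum_mem fun t _ => ?_, fun r l hrl => ?_, fun R hvR hyR m => ?_⟩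
  · exact mul_mem (mul_mem (star_mem (hv _)) (mul_mem (mul_mem (hv _) (hx _)) (star_mem (hv _))))
      (hv _)
  · rw [hsum]
    exact Finset.sum_eq_zero fun t _ => hb0 t r l (hrl t)
  · have hbR : ∀ t, b t ∈ R := by
      intro t
      have := hyR t
      rw [hsum, Finset.sum_eq_single t (fun s _ hst => hb0 s _ _ fun hs => hst (hσ hs))
        (fun ht => absurd (Finset.mem_univ t) ht), hb t] at this
      exact this
    rw [h.eq_sum_blocks (x m)]
    refine sum_mem fun i _ => sum_mem fun j _ => ?_
    by_cases hne : p i * x m * p j = 0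
    · rw [hne]; exact zero_mem R
    · let t : T := ⟨(m, i, j), hT m i j hne⟩
      have hrec : p i * x m * p j =
          star (v i) * (v (σ t).1 * b t * star (v (σ t).2)) * v j := by
        have e1 : v (σ t).1 * star (v (σ t).1) = p o := h.final _
        have e2 : v (σ t).2 * star (v (σ t).2) = p o := h.final _
        have e3 : v (σ t).1 * b t * star (v (σ t).2) =
            p o * (v i * x m * star (v j)) * p o := by
          simp only [b]
          rw [← mul_assoc, ← mul_assoc, e1, mul_assoc _ (v _) (star _), e2]
        have e4 : star (v i) * p o = star (v i) := by
          have := congr(star $(h.proj_mul i))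
          rwa [star_mul, (h.isStarProjection o).isSelfAdjoint.star_eq] at this
        rw [e3, ← mul_assoc, ← mul_assoc, e4, mul_assoc _ (p o) (v j), h.proj_mul, ← mul_assoc,
          ← mul_assoc, h.initial, mul_assoc _ (star (v j)) (v j), h.initial]
      rw [hrec]
      exact mul_mem (mul_mem (star_mem (hvR _)) (mul_mem (mul_mem (hvR _) (hbR t))
        (star_mem (hvR _)))) (hvR _)

end IsMatrixUnitRow

/-! ### Single generation from few blocks -/

theorem frequently_genCountAt_lt {P : VonNeumannAlgebra H} {τ : P →ₗ[ℂ] ℂ} {c : ℝ≥0∞}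
    (h : P.genCount τ < c) : ∃ᶠ K in atTop, P.genCountAt τ K < c :=
  frequently_lt_of_liminf_lt (by isBoundedDefault) h

/-- A set of at most `L²` indices fits into an `L × L` square. -/
theorem exists_injective_square {α : Type*} {T : Finset α} {L : ℕ} (h : T.card ≤ L ^ 2) :
    ∃ σ : T → Fin L × Fin L, Function.Injective σ := by
  have hc : Fintype.card T ≤ Fintype.card (Fin L × Fin L) := by
    simpa [sq] using h
  obtain ⟨e⟩ := Function.Embedding.nonempty_of_card_le hc
  exact ⟨e, e.injective⟩

/-- Distinct coefficients separate the spectral projections of a diagonal operator. -/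
theorem proj_mem_of_diagonal_mem {R : VonNeumannAlgebra H} {K : ℕ} {p : Fin K → H →L[ℂ] H}
    (hp : ∀ j, IsStarProjection (p j)) (ho : ∀ i j, i ≠ j → p i * p j = 0)
    (hsum : ∑ j, p j = 1) (hR : ∑ j : Fin K, ((j : ℕ) : ℂ) • p j ∈ R) (j : Fin K) : p j ∈ R := by
  set a := ∑ j : Fin K, ((j : ℕ) : ℂ) • p j with ha
  have hap : ∀ j : Fin K, a * p j = ((j : ℕ) : ℂ) • p j := by
    intro j
    rw [ha, Finset.sum_mul, Finset.sum_eq_single j (fun i _ hij => by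
      rw [smul_mul_assoc, ho i j hij, smul_zero]) (fun h => absurd (Finset.mem_univ _) h),
      smul_mul_assoc, (hp j).isIdempotentElem.eq]
  have hpa : ∀ j : Fin K, p j * a = ((j : ℕ) : ℂ) • p j := by
    intro j
    rw [ha, Finset.mul_sum, Finset.sum_eq_single j (fun i _ hij => by
      rw [mul_smul_comm, ho j i hij.symm, smul_zero]) (fun h => absurd (Finset.mem_univ _) h),
      mul_smul_comm, (hp j).isIdempotentElem.eq]
  refine mem_of_forall_commute fun w hw => ?_
  have hoff : ∀ i j, i ≠ j → p i * w * p j = 0 := by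
    intro i j hij
    have h1 : p i * (a * w) * p j = ((i : ℕ) : ℂ) • (p i * w * p j) := by
      rw [← mul_assoc, hpa, smul_mul_assoc, smul_mul_assoc]
    have h2 : p i * (w * a) * p j = ((j : ℕ) : ℂ) • (p i * w * p j) := by
      rw [mul_assoc, mul_assoc w, hap, mul_smul_comm, mul_smul_comm, mul_assoc]
    rw [hw a hR, h2, ← sub_eq_zero, ← sub_smul, smul_eq_zero] at h1
    refine h1.resolve_left fun h => hij ?_
    have := sub_eq_zero.1 h
    exact (Fin.ext (Nat.cast_injective this)).symm
  have h1 : w * p j = p j * w * p j := by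
    conv_lhs => rw [← one_mul (w * p j), ← hsum, Finset.sum_mul]
    rw [Finset.sum_eq_single j (fun i _ hij => by rw [← mul_assoc, hoff i j hij])
      (fun h => absurd (Finset.mem_univ _) h), mul_assoc]
  have h2 : p j * w = p j * w * p j := by
    conv_lhs => rw [← mul_one (p j * w), ← hsum, Finset.mul_sum]
    rw [Finset.sum_eq_single j (fun i _ hij => hoff j i hij.symm)
      (fun h => absurd (Finset.mem_univ _) h)]
  rw [h1, ← h2]

/-- If at most `K² / 16` blocks of the generators are nonzero, one operator generates: its real part
is diagonal with distinct eigenvalues, and its imaginary part carries, above the diagonal, the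
matrix units in row `0` and the packed blocks in a square of side `K / 3` below that row. -/
theorem isSinglyGenerated_of_card_le {M : VonNeumannAlgebra H} {K n : ℕ} {o : Fin K}
    {p v : Fin K → H →L[ℂ] H} (h : IsMatrixUnitRow p v o) (hv : ∀ j, v j ∈ M)
    {x : Fin n → H →L[ℂ] H} (hx : generatedBy (Set.range x) = M)
    {T : Finset (Fin n × Fin K × Fin K)} (hT : ∀ m i j, p i * x m * p j ≠ 0 → (m, i, j) ∈ T)
    (hcard : 16 * T.card ≤ K ^ 2) (hK : 8 ≤ K) (ho : (o : ℕ) = 0) : M.IsSinglyGenerated := by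
  have hpM : ∀ j, p j ∈ M := fun j => h.initial j ▸ mul_mem (star_mem (hv j)) (hv j)
  have hsa : ∀ j, star (p j) = p j := fun j => (h.isStarProjection j).isSelfAdjoint.star_eq
  obtain ⟨L, hL⟩ : ∃ L, L = K / 3 := ⟨_, rfl⟩
  have hLK : 2 * L + 1 ≤ K := by omega
  have hKL : K ≤ 4 * L := by omega
  have hcard' : T.card ≤ L ^ 2 := by
    have : K ^ 2 ≤ (4 * L) ^ 2 := Nat.pow_le_pow_left hKL 2
    nlinarith
  obtain ⟨ρ, hρ⟩ := exists_injective_square hcard'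
  -- rows `1, …, L` and columns `L + 1, …, 2L`
  let σ : T → Fin K × Fin K := fun t =>
    (⟨(ρ t).1 + 1, by omega⟩, ⟨(ρ t).2 + L + 1, by omega⟩)
  have hσ : Function.Injective σ := by
    intro s t hst
    simp only [σ, Prod.mk.injEq, Fin.mk.injEq] at hst
    exact hρ (Prod.ext (Fin.ext (by omega)) (Fin.ext (by omega)))
  obtain ⟨y, hyM, hy0, hyR⟩ := h.exists_packing hv
    (fun m => hx ▸ mem_generatedBy (Set.mem_range_self m)) hT hσ
  let b : H →L[ℂ] H := (∑ j ∈ Finset.univ.erase o, v j) + y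
  have hrow : ∀ r l, p r * (∑ j ∈ Finset.univ.erase o, v j) * p l =
      if r = o ∧ l ≠ o then v l else 0 := by
    intro r l
    rw [Finset.mul_sum, Finset.sum_mul]
    by_cases hr : r = o
    · subst hr
      have e : ∀ j, p r * v j * p l = if j = l then v l else 0 := by
        intro j
        rw [h.proj_mul]
        split_ifs with hjl
        · rw [hjl, h.mul_proj]
        · exact h.mul_proj_of_ne hjl
      rw [Finset.sum_congr rfl fun j _ => e j, Finset.sum_ite_eq']
      simp
    · rw [if_neg (fun hh => hr hh.1)]
      exact Finset.sum_eq_zero fun j _ => by rw [h.proj_mul_of_ne hr, zero_mul]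
  have hb : ∀ r l, p r * b * p l = (if r = o ∧ l ≠ o then v l else 0) + p r * y * p l := by
    intro r l
    rw [← hrow, mul_add, add_mul]
  have hb_low : ∀ r l : Fin K, l < r → p r * b * p l = 0 := by
    intro r l hlr
    rw [hb, if_neg, zero_add]
    · refine hy0 r l fun t ht => ?_
      have h1 : ((ρ t).1 : ℕ) + 1 = r := congrArg (fun z => (z.1 : ℕ)) ht
      have h2 : ((ρ t).2 : ℕ) + L + 1 = l := congrArg (fun z => (z.2 : ℕ)) ht
      have := Fin.lt_def.1 hlr
      have := (ρ t).1.2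
      omega
    · rintro ⟨rfl, -⟩
      have := Fin.lt_def.1 hlr
      omega
  have hz : ∀ r l : Fin K, r < l → p r * (b + star b) * p l = p r * b * p l := by
    intro r l hrl
    have e : p r * star b * p l = 0 := by
      have := congr(star $(hb_low l r hrl))
      simpa [hsa, mul_assoc] using this
    rw [mul_add, add_mul, e, add_zero]
  let a : H →L[ℂ] H := ∑ j : Fin K, ((j : ℕ) : ℂ) • p j
  have ha : star a = a := by
    simp only [a, star_sum, star_smul, hsa]
    simp
  have hbM : b ∈ M := add_mem (sum_mem fun j _ => hv j) hyM
  have haM : a ∈ M := sum_mem fun j _ => SMulMemClass.smul_mem _ (hpM j)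
  refine ⟨a + Complex.I • (b + star b), (generatedBy_eq_iff ?_).2 ?_⟩
  · rw [Set.singleton_subset_iff]
    exact add_mem haM (SMulMemClass.smul_mem _ (add_mem hbM (star_mem hbM)))
  intro R hR
  have hgR := Set.singleton_subset_iff.1 hR
  have hgR' := star_mem hgR
  have hstar : star (a + Complex.I • (b + star b)) = a - Complex.I • (b + star b) := by
    rw [star_add, ha, star_smul, star_add, star_star, add_comm (star b)]
    simp [sub_eq_add_neg, add_comm]
  rw [SetLike.mem_coe] at hgR
  have haR : a ∈ R := by
    have := SMulMemClass.smul_mem (1 / 2 : ℂ) (add_mem hgR hgR')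
    rw [hstar] at this
    convert this using 1
    module
  have hzR : b + star b ∈ R := by
    have h1 := sub_mem hgR haR
    rw [add_sub_cancel_left] at h1
    have := SMulMemClass.smul_mem (-Complex.I) h1
    rwa [smul_smul, neg_mul, Complex.I_mul_I, neg_neg, one_smul] at this
  have hpR := proj_mem_of_diagonal_mem h.isStarProjection h.orthogonal h.sum_eq_one haR
  have hblock : ∀ r l : Fin K, r < l → p r * b * p l ∈ R := by
    intro r l hrl
    rw [← hz r l hrl]
    exact mul_mem (mul_mem (hpR r) hzR) (hpR l)
  have hvR : ∀ j, v j ∈ R := by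
    intro j
    by_cases hj : j = o
    · rw [hj, h.diagonal]; exact hpR o
    · have h1 := hblock o j (Fin.lt_def.2 (by
        have : (j : ℕ) ≠ o := fun hh => hj (Fin.ext hh)
        omega))
      rw [hb, if_pos ⟨rfl, hj⟩, hy0 o j, add_zero] at h1
      · exact h1
      · intro t ht
        have : ((ρ t).1 : ℕ) + 1 = o := congrArg (fun z => (z.1 : ℕ)) ht
        omega
  rw [← hx, generatedBy_le_iff]
  rintro _ ⟨m, rfl⟩
  refine hyR R hvR (fun t => ?_) m
  have h1 := hblock (σ t).1 (σ t).2 (Fin.lt_def.2 (by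
    have := (ρ t).1.2
    simp only [σ]
    omega))
  rwa [hb, if_neg, zero_add] at h1
  rintro ⟨h2, -⟩
  have : ((ρ t).1 : ℕ) + 1 = o := congrArg Fin.val h2
  omega

theorem isSinglyGenerated_of_genCount_eq_zero {M : VonNeumannAlgebra H} {τ : M →ₗ[ℂ] ℂ}
    {φ : (H →L[ℂ] H) →ₗ[ℂ] ℂ} (hτφ : ∀ x : M, τ x = φ x) (hφ : M.IsTraceOn φ)
    (hM : M.IsFactor) (h0 : M.genCount τ = 0) : M.IsSinglyGenerated := by
  have hfr := frequently_genCountAt_lt (P := M) (τ := τ) (c := ENNReal.ofReal (1 / 16))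
    (by rw [h0]; exact ENNReal.ofReal_pos.2 (by norm_num))
  obtain ⟨K, hlt, hK⟩ := (hfr.and_eventually (eventually_ge_atTop 8)).exists
  obtain ⟨n, x, p, T, hx, hp, hT, hcard⟩ := exists_of_genCountAt_lt hτφ (by omega) hlt
  obtain ⟨v, hv, hrow⟩ := hp.exists_isMatrixUnitRow hφ hM ⟨0, by omega⟩
  refine isSinglyGenerated_of_card_le hrow hv hx hT ?_ hK rfl
  have : (16 : ℝ) * T.card ≤ (K : ℝ) ^ 2 := by linarith
  exact_mod_cast this

/-! ### Enlarging a subfactor by one small operator -/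

theorem commute_of_mem_generatedBy {S : Set (H →L[ℂ] H)} {z y : H →L[ℂ] H}
    (hz : z ∈ generatedBy S) (hy : ∀ s ∈ S, s * y = y * s ∧ star s * y = y * star s) :
    y * z = z * y := by
  have hyS : y ∈ StarSubalgebra.centralizer ℂ S := by
    rw [StarSubalgebra.mem_centralizer_iff]
    exact hy
  have hz' : z ∈ StarSubalgebra.centralizer ℂ
    (StarSubalgebra.centralizer ℂ S : Set (H →L[ℂ] H)) := hz
  rw [StarSubalgebra.mem_centralizer_iff] at hz'
  exact (hz' y hyS).1

/-- Conjugating generators by a unitary of the algebra gives generators. -/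
theorem generatedBy_conj {P : VonNeumannAlgebra H} {ι : Type*} {x : ι → H →L[ℂ] H}
    (hx : generatedBy (Set.range x) = P) {u : H →L[ℂ] H} (huP : u ∈ P)
    (hu : star u * u = 1) (hu' : u * star u = 1) :
    generatedBy (Set.range fun m => u * x m * star u) = P := by
  have hxP : ∀ m, x m ∈ P := fun m => hx ▸ mem_generatedBy (Set.mem_range_self m)
  refine (generatedBy_eq_iff ?_).2 fun R hR z hz => mem_of_forall_commute fun y hy => ?_
  · rintro _ ⟨m, rfl⟩
    exact mul_mem (mul_mem huP (hxP m)) (star_mem huP)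
  have hxR : ∀ m, u * x m * star u ∈ R := fun m => hR (Set.mem_range_self m)
  have aux : ∀ {c : H →L[ℂ] H}, u * c * star u ∈ R →
      c * (star u * y * u) = (star u * y * u) * c := by
    intro c hc
    have h1 := hy _ hc
    calc c * (star u * y * u) = star u * u * c * (star u * y * u) := by rw [hu, one_mul]
      _ = star u * ((u * c * star u) * y) * u := by simp only [mul_assoc]
      _ = star u * y * u * c * (star u * u) := by rw [h1]; simp only [mul_assoc]
      _ = (star u * y * u) * c := by rw [hu, mul_one]
  have hw : ∀ z ∈ P, (star u * y * u) * z = z * (star u * y * u) := by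
    intro z hz
    refine commute_of_mem_generatedBy (hx.symm ▸ hz) ?_
    rintro _ ⟨m, rfl⟩
    refine ⟨aux (hxR m), aux ?_⟩
    have := star_mem (hxR m)
    simpa [mul_assoc] using this
  have hyw : star u * y * u = y := by
    have h1 := hw u huP
    rw [← mul_assoc, ← mul_assoc, hu', one_mul] at h1
    calc star u * y * u = (star u * y * u * u) * star u := by rw [mul_assoc _ u, hu', mul_one]
      _ = y := by rw [h1, mul_assoc, hu', mul_one]
  have := hw z hz
  rwa [hyw] at this

/-- In a factor, any two equal partitions of the same size are unitarily conjugate. -/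
theorem IsEqualPartition.exists_unitary {P : VonNeumannAlgebra H} {φ : (H →L[ℂ] H) →ₗ[ℂ] ℂ}
    {K : ℕ} {p q : Fin K → H →L[ℂ] H} (hp : P.IsEqualPartition φ p)
    (hq : P.IsEqualPartition φ q) (hφ : P.IsTraceOn φ) (hP : P.IsFactor) (hK : K ≠ 0) :
    ∃ u ∈ P, star u * u = 1 ∧ u * star u = 1 ∧ ∀ j, q j * u = u * p j := by
  have h : ∀ j, ∃ v ∈ P, star v * v = p j ∧ v * star v = q j := fun j =>
    hφ.exists_equiv hP (hp.mem j) (hq.mem j) (hp.isStarProjection j) (hq.isStarProjection j)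
      (by rw [hp.trace_eq, hq.trace_eq])
  choose v hvP hvp hvq using h
  have hpi : ∀ j, v j * star (v j) * v j = v j := fun j =>
    isPartialIsometry_of_star_mul_self (hvp j ▸ hp.isStarProjection j)
  have hvj : ∀ j, v j * p j = v j := fun j => by rw [← hvp, ← mul_assoc, hpi]
  have hqv : ∀ j, q j * v j = v j := fun j => by rw [← hvq, hpi]
  have hqv0 : ∀ i j, i ≠ j → q i * v j = 0 := fun i j hij => by
    rw [← hqv j, ← mul_assoc, hq.orthogonal i j hij, zero_mul]
  have hvp0 : ∀ i j, i ≠ j → v i * p j = 0 := fun i j hij => by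
    rw [← hvj i, mul_assoc, hp.orthogonal i j hij, mul_zero]
  have hqu : ∀ j, q j * ∑ i, v i = v j := fun j => by
    rw [Finset.mul_sum, Finset.sum_eq_single j (fun i _ hij => hqv0 j i hij.symm)
      (fun h => absurd (Finset.mem_univ _) h), hqv]
  have hup : ∀ j, (∑ i, v i) * p j = v j := fun j => by
    rw [Finset.sum_mul, Finset.sum_eq_single j (fun i _ hij => hvp0 i j hij)
      (fun h => absurd (Finset.mem_univ _) h), hvj]
  have hsu : star (∑ i, v i) = ∑ i, star (v i) := star_sum _ _
  refine ⟨∑ i, v i, sum_mem fun i _ => hvP i, ?_, ?_, fun j => by rw [hqu, hup]⟩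
  · rw [hsu, Finset.sum_mul, ← hp.sum_eq_one hφ hK]
    refine Finset.sum_congr rfl fun j _ => ?_
    have : star (v j) = star (v j) * q j := by
      have := congr(star $(hqv j))
      rwa [star_mul, (hq.isStarProjection j).isSelfAdjoint.star_eq, eq_comm] at this
    rw [this, mul_assoc, hqu, hvp]
  · rw [hsu, Finset.mul_sum, ← hq.sum_eq_one hφ hK]
    refine Finset.sum_congr rfl fun j _ => ?_
    have : star (v j) = p j * star (v j) := by
      have := congr(star $(hvj j))
      rwa [star_mul, (hp.isStarProjection j).isSelfAdjoint.star_eq, eq_comm] at this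
    rw [this, ← mul_assoc, hup, hvq]

/-- Let factors `Q` and `P` share a diffuse subalgebra, and let `f ∈ Q` be a projection with
`𝓖(P) ≤ τ(f)² / 8`. Then a single operator supported under `f` generates, together with
`Q`, all of `P`: after conjugation the blocks of generators of `P` refer to projections of `Q`, and
partial isometries of `Q` bring the nonzero blocks under `f`. -/
theorem exists_operator_under_projection {M Q P D : VonNeumannAlgebra H}
    {φ : (H →L[ℂ] H) →ₗ[ℂ] ℂ} (hφ : M.IsTraceOn φ) (hQM : Q ≤ M) (hQ : Q.IsFactor)
    (hPM : P ≤ M) (hP : P.IsFactor) (hDQ : D ≤ Q) (hDP : D ≤ P) (hD : D.IsDiffuse)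
    {τ : P →ₗ[ℂ] ℂ} (hτφ : ∀ x : P, τ x = φ x) {f : H →L[ℂ] H} (hfQ : f ∈ Q)
    (hf : IsStarProjection f) (hf0 : f ≠ 0)
    (hgc : P.genCount τ ≤ ENNReal.ofReal ((φ f).re ^ 2 / 8)) :
    ∃ y ∈ M, f * y * f = y ∧ ∀ R : VonNeumannAlgebra H, Q ≤ R → y ∈ R → P ≤ R := by
  have hφQ := hφ.mono hQM
  have hφP := hφ.mono hPM
  set s := (φ f).re with hs
  have hs0 : 0 < s := hφQ.re_pos hfQ hf hf0
  have hs1 : s ≤ 1 := by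
    have := hφQ.re_mono (one_mem Q) hfQ (.one _) hf (one_mul f)
    rwa [hφ.map_one, Complex.one_re] at this
  have hfr := frequently_genCountAt_lt (P := P) (τ := τ) (c := ENNReal.ofReal (s ^ 2 / 4))
    (hgc.trans_lt ((ENNReal.ofReal_lt_ofReal_iff (by positivity)).2 (by
      have : 0 < s ^ 2 := by positivity
      linarith)))
  obtain ⟨N, hN⟩ := exists_nat_gt (2 / s)
  obtain ⟨K, hlt, hK⟩ := (hfr.and_eventually (eventually_ge_atTop (N + 1))).exists
  have hK0 : K ≠ 0 := by omega
  have hKpos : (0 : ℝ) < K := by positivity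
  have hsK : 2 ≤ s * K := by
    have h1 : (N : ℝ) ≤ K := by exact_mod_cast (by omega : N ≤ K)
    have h2 : 2 / s ≤ K := (hN.le).trans h1
    rw [div_le_iff₀ hs0] at h2
    linarith
  obtain ⟨n, x, p, T, hx, hp, hT, hcard⟩ := exists_of_genCountAt_lt hτφ hK0 hlt
  obtain ⟨q, hqD⟩ := (hφQ.mono hDQ).exists_isEqualPartition hD hK0
  have hq := hqD.mono hDQ
  obtain ⟨u, huP, hu, hu', huq⟩ := hp.exists_unitary (hqD.mono hDP) hφP hP hK0
  have hx' := generatedBy_conj hx huP hu hu'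
  have hT' : ∀ m i j, q i * (u * x m * star u) * q j ≠ 0 → (m, i, j) ∈ T := by
    intro m i j hne
    refine hT m i j fun h0 => hne ?_
    have e : star u * q j = p j * star u := by
      have := congr(star $(huq j))
      rwa [star_mul, star_mul, (hp.isStarProjection j).isSelfAdjoint.star_eq,
        (hq.isStarProjection j).isSelfAdjoint.star_eq] at this
    calc q i * (u * x m * star u) * q j = (q i * u) * x m * (star u * q j) := by
          simp only [mul_assoc]
      _ = u * (p i * x m * p j) * star u := by rw [huq, e]; simp only [mul_assoc]
      _ = 0 := by rw [h0, mul_zero, zero_mul]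
  obtain ⟨v, hvQ, hrow⟩ := hq.exists_isMatrixUnitRow hφQ hQ ⟨0, Nat.pos_of_ne_zero hK0⟩
  -- the first `L` projections of the partition have total trace `L / K ≤ s`
  obtain ⟨L, hL⟩ : ∃ L, L = ⌊s * (K : ℝ)⌋₊ := ⟨_, rfl⟩
  have hLle : (L : ℝ) ≤ s * K := hL ▸ Nat.floor_le (by positivity)
  have hLge : s * K / 2 ≤ L := by
    have := Nat.lt_floor_add_one (s * (K : ℝ))
    rw [← hL] at this
    linarith
  have hLK : L ≤ K := by
    have : (L : ℝ) ≤ K := hLle.trans (by nlinarith)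
    exact_mod_cast this
  have hcardL : T.card ≤ L ^ 2 := by
    have h1 : (s * K / 2) ^ 2 ≤ (L : ℝ) ^ 2 := by gcongr
    have h2 : (T.card : ℝ) ≤ (L : ℝ) ^ 2 := by
      refine hcard.trans (le_trans (le_of_eq ?_) h1)
      ring
    exact_mod_cast h2
  obtain ⟨ρ, hρ⟩ := exists_injective_square hcardL
  let σ : T → Fin K × Fin K := fun t => (Fin.castLE hLK (ρ t).1, Fin.castLE hLK (ρ t).2)
  have hσ : Function.Injective σ := by
    intro a b hab
    simp only [σ, Prod.mk.injEq, Fin.castLE_inj] at hab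
    exact hρ (Prod.ext hab.1 hab.2)
  obtain ⟨y, hyM, -, hyR⟩ := hrow.exists_packing (M := M) (fun j => hQM (hvQ j))
    (fun m => hPM (hx' ▸ mem_generatedBy (Set.mem_range_self m))) hT' hσ
  let S : Finset (Fin K) := Finset.univ.map (Fin.castLEEmb hLK)
  have hg : IsStarProjection (∑ j ∈ S, q j) :=
    isStarProjection_sum S hq.isStarProjection hq.orthogonal
  have hgQ : ∑ j ∈ S, q j ∈ Q := sum_mem fun j _ => hq.mem j
  have hgf : (φ (∑ j ∈ S, q j)).re ≤ (φ f).re := by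
    rw [map_sum, Finset.sum_congr rfl fun j _ => hq.trace_eq j, Finset.sum_const]
    have : S.card = L := by simp [S]
    rw [this, nsmul_eq_mul, mul_one_div]
    have e : ((L : ℂ) / (K : ℂ)) = ((L / K : ℝ) : ℂ) := by push_cast; rfl
    rw [e, Complex.ofReal_re, div_le_iff₀ hKpos]
    exact hLle
  obtain ⟨w, hwQ, hw, hfw⟩ := hφQ.exists_partialIsometry hQ hgQ hfQ hg hf hgf
  have hwf : star w * f = star w := by
    have := congr(star $hfw)
    rwa [star_mul, hf.isSelfAdjoint.star_eq] at this
  refine ⟨w * y * star w, mul_mem (mul_mem (hQM hwQ) hyM) (star_mem (hQM hwQ)), ?_, ?_⟩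
  · rw [mul_assoc f, mul_assoc _ (star w) f, hwf, ← mul_assoc, ← mul_assoc, hfw]
  intro R hQR hwyR
  rw [← hx', generatedBy_le_iff]
  rintro _ ⟨m, rfl⟩
  refine hyR R (fun j => hQR (hvQ j)) (fun t => ?_) m
  have hqg : ∀ a : Fin L, q (Fin.castLE hLK a) * ∑ j ∈ S, q j = q (Fin.castLE hLK a) := by
    intro a
    rw [Finset.mul_sum, Finset.sum_eq_single (Fin.castLE hLK a)
      (fun j _ hj => hq.orthogonal _ _ hj.symm)
      (fun h => absurd (Finset.mem_map_of_mem _ (Finset.mem_univ a)) h),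
      (hq.isStarProjection _).isIdempotentElem.eq]
  have hgq : ∀ a : Fin L, (∑ j ∈ S, q j) * q (Fin.castLE hLK a) = q (Fin.castLE hLK a) :=
    fun a => by
    have := congr(star $(hqg a))
    rwa [star_mul, hg.isSelfAdjoint.star_eq, (hq.isStarProjection _).isSelfAdjoint.star_eq] at this
  have hmem : star w * (w * y * star w) * w ∈ R :=
    mul_mem (mul_mem (star_mem (hQR hwQ)) hwyR) (hQR hwQ)
  have e : q (σ t).1 * y * q (σ t).2 =
      q (σ t).1 * (star w * (w * y * star w) * w) * q (σ t).2 := by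
    have e1 : star w * (w * y * star w) * w = (∑ j ∈ S, q j) * y * ∑ j ∈ S, q j := by
      rw [← hw]; simp only [mul_assoc]
    rw [e1, ← mul_assoc, ← mul_assoc, hqg, mul_assoc _ (∑ j ∈ S, q j), hgq]
  rw [e]
  exact mul_mem (mul_mem (hQR (hq.mem _)) hmem) (hQR (hq.mem _))

/-! ### Infinitely many subfactors in one operator -/

/-- Irreducibility forces every intermediate algebra to be a factor. -/
theorem IsIrreducibleSubfactor.isFactor_of_le {P Q M : VonNeumannAlgebra H}
    (hP : P.IsIrreducibleSubfactor M) (hPQ : P ≤ Q) (hQM : Q ≤ M) : Q.IsFactor :=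
  fun z hz h => hP.relativeCommutant z (hQM hz) fun y hy => h y (hPQ hy)

/-- One operator supported under an arbitrarily small projection `f` of an irreducible subfactor
`P ⊇ N 0` generates `M` together with `P`. The `k`-th step puts a subfactor that contains
`N (k + 1)` under the `k`-th of an orthogonal sequence of subprojections of `f`, and these
operators are summed. -/
theorem exists_generating_operator {M : VonNeumannAlgebra H} {τ : M →ₗ[ℂ] ℂ}
    {φ : (H →L[ℂ] H) →ₗ[ℂ] ℂ} (hφ : M.IsTraceOn φ) (hτφ : ∀ x : M, τ x = φ x)
    {N : ℕ → VonNeumannAlgebra H} (hgen : generatedBy (⋃ k, (N k : Set (H →L[ℂ] H))) = M)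
    (hdiff : ∀ k, ((N k).inter (N (k + 1))).IsDiffuse)
    (hsub : ∀ k, ∀ ε : ℝ, 0 < ε →
      ∃ (P : VonNeumannAlgebra H) (hP : P.IsIrreducibleSubfactor M),
        N k ≤ P ∧ P.genCount (restrict hP.le τ) ≤ ENNReal.ofReal ε)
    {P₀ : VonNeumannAlgebra H} (hP₀ : P₀.IsIrreducibleSubfactor M) (hNP₀ : N 0 ≤ P₀)
    {f : H →L[ℂ] H} (hfP₀ : f ∈ P₀) (hf : IsStarProjection f) (hf0 : f ≠ 0) :
    ∃ y ∈ M, f * y * f = y ∧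
      ∀ R : VonNeumannAlgebra H, P₀ ≤ R → y ∈ R → M ≤ R := by
  have hφ₀ := hφ.mono hP₀.le
  have hdiff₀ : P₀.IsDiffuse := hφ₀.isDiffuse_of_le hP₀.isFactor (hdiff 0)
    ((inter_le_left _ _).trans hNP₀)
  obtain ⟨g, hgP₀, hg, hg0, hfg, hgo⟩ := hdiff₀.exists_orthogonal_seq hfP₀ hf hf0
  have hpos : ∀ k, 0 < (φ (g k)).re := fun k => hφ₀.re_pos (hgP₀ k) (hg k) (hg0 k)
  choose P hP hNP hPc using fun k =>
    hsub (k + 1) ((φ (g k)).re ^ 2 / 8) (by have := hpos k; positivity)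
  let Q : ℕ → VonNeumannAlgebra H := fun k =>
    generatedBy ((P₀ : Set (H →L[ℂ] H)) ∪ ⋃ i ∈ Set.Iio k, (P i : Set (H →L[ℂ] H)))
  have hQ_le : ∀ (k : ℕ) (R : VonNeumannAlgebra H), P₀ ≤ R → (∀ i < k, P i ≤ R) → Q k ≤ R := by
    intro k R h0 hi
    refine generatedBy_le_iff.2 (Set.union_subset h0 (Set.iUnion₂_subset fun i hik => ?_))
    exact hi i hik
  have hP₀Q : ∀ k, P₀ ≤ Q k := fun k x hx => mem_generatedBy (Or.inl hx)
  have hPQ : ∀ i k, i < k → P i ≤ Q k := fun i k hik x hx =>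
    mem_generatedBy (Or.inr (Set.mem_iUnion₂.2 ⟨i, hik, hx⟩))
  have hQM : ∀ k, Q k ≤ M := fun k => hQ_le k M hP₀.le fun i _ => (hP i).le
  have hNQ : ∀ k, N k ≤ Q k := by
    intro k
    cases k with
    | zero => exact hNP₀.trans (hP₀Q 0)
    | succ k => exact (hNP k).trans (hPQ k (k + 1) (Nat.lt_succ_self k))
  have hstep : ∀ k, ∃ y ∈ M, g k * y * g k = y ∧
      ∀ R : VonNeumannAlgebra H, Q k ≤ R → y ∈ R → P k ≤ R := fun k =>
    exists_operator_under_projection hφ (hQM k) (hP₀.isFactor_of_le (hP₀Q k) (hQM k)) (hP k).le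
      (hP k).isFactor ((inter_le_left _ _).trans (hNQ k))
      ((inter_le_right _ _).trans (hNP k)) (hdiff k)
      (fun x => hτφ ⟨x, (hP k).le x.2⟩) (hP₀Q k (hgP₀ k)) (hg k) (hg0 k) (hPc k)
  choose y hyM hgy hyR using hstep
  -- scaling makes the sum converge in norm and does not affect what `y k` generates
  let c : ℕ → ℂ := fun k => (((1 / 2 : ℝ) ^ k / (‖y k‖ + 1) : ℝ) : ℂ)
  have hc0 : ∀ k, c k ≠ 0 := fun k => by
    have : (0 : ℝ) < (1 / 2 : ℝ) ^ k / (‖y k‖ + 1) := by positivity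
    exact Complex.ofReal_ne_zero.2 this.ne'
  have hnorm : ∀ k, ‖c k • y k‖ ≤ (1 / 2 : ℝ) ^ k := by
    intro k
    rw [norm_smul, Complex.norm_real, Real.norm_of_nonneg (by positivity), div_mul_eq_mul_div,
      div_le_iff₀ (by positivity)]
    gcongr
    linarith
  have hsum : HasSum (fun k => c k • y k) (∑' k, c k • y k) :=
    (Summable.of_norm_bounded (summable_geometric_of_lt_one (by norm_num) (by norm_num))
      hnorm).hasSum
  set z := ∑' k, c k • y k
  have hgz : ∀ k, g k * z * g k = c k • y k := by
    intro k
    refine ((hsum.mul_left (g k)).mul_right (g k)).unique ?_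
    have h1 : ∀ i, i ≠ k → g k * (c i • y i) * g k = 0 := by
      intro i hik
      rw [← hgy i, mul_smul_comm, ← mul_assoc, ← mul_assoc, hgo k i hik.symm, zero_mul, zero_mul,
        smul_zero, zero_mul]
    have h2 := hasSum_single (f := fun i => g k * (c i • y i) * g k) k h1
    simp only [mul_smul_comm, smul_mul_assoc, hgy] at h2 ⊢
    exact h2
  refine ⟨z, ?_, ?_, fun R hR hzR => ?_⟩
  · refine mem_of_tendsto (x := fun n => ∑ k ∈ Finset.range n, c k • y k) (l := atTop)
      (fun n => sum_mem fun k _ => SMulMemClass.smul_mem (c k) (hyM k)) fun ξ => ?_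
    exact ((ContinuousLinearMap.apply ℂ H ξ).continuous.tendsto _).comp hsum.tendsto_sum_nat
  · refine ((hsum.mul_left f).mul_right f).unique ?_
    have h1 : ∀ i, f * (c i • y i) * f = c i • y i := by
      intro i
      have h2 := mul_eq_of_isStarProjection hf (hg i) (hfg i)
      rw [mul_smul_comm, smul_mul_assoc]
      conv_lhs => rw [← hgy i]
      rw [mul_assoc f, mul_assoc _ (g i) f, h2, ← mul_assoc, ← mul_assoc, hfg, hgy]
    simpa only [h1] using hsum
  · have hyR' : ∀ k, y k ∈ R := by
      intro k
      have h1 : c k • y k ∈ R := by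
        rw [← hgz k]
        exact mul_mem (mul_mem (hR (hgP₀ k)) hzR) (hR (hgP₀ k))
      have h2 := SMulMemClass.smul_mem (c k)⁻¹ h1
      rwa [smul_smul, inv_mul_cancel₀ (hc0 k), one_smul] at h2
    have hPR : ∀ k, P k ≤ R := by
      intro k
      induction k using Nat.strong_induction_on with
      | _ k ih => exact hyR k R (hQ_le k R hR ih) (hyR' k)
    rw [← hgen]
    refine generatedBy_le_iff.2 (Set.iUnion_subset fun k => ?_)
    cases k with
    | zero => exact hNP₀.trans hR
    | succ k => exact (hNP k).trans (hPR k)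

end VonNeumannAlgebra

open VonNeumannAlgebra

theorem proposition5p1 {H : Type*} [NormedAddCommGroup H] [InnerProductSpace ℂ H]
    [CompleteSpace H] [TopologicalSpace.SeparableSpace H]
    (M : VonNeumannAlgebra H) (hM : M.IsTypeIIOneFactor)
    (τ : M →ₗ[ℂ] ℂ) (hτ : M.IsTracialState τ)
    (N : ℕ → VonNeumannAlgebra H) (hNM : ∀ k, N k ≤ M)
    (hgen : VonNeumannAlgebra.generatedBy (⋃ k, (N k : Set (H →L[ℂ] H))) = M)
    (hdiff : ∀ k, ((N k).inter (N (k + 1))).IsDiffuse)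
    (hsub : ∀ k, ∀ ε : ℝ, 0 < ε →
      ∃ (P : VonNeumannAlgebra H) (hP : P.IsIrreducibleSubfactor M),
        N k ≤ P ∧ P.genCount (VonNeumannAlgebra.restrict hP.le τ) ≤ ENNReal.ofReal ε) :
    M.genCount τ = 0 ∧ M.IsSinglyGenerated := by
  obtain ⟨φ, hφ, hτφ⟩ := hτ.exists_isTraceOn
  suffices h0 : M.genCount τ = 0 from
    ⟨h0, isSinglyGenerated_of_genCount_eq_zero hτφ hφ hM.isFactor h0⟩
  refine le_antisymm (ENNReal.le_of_forall_pos_le_add fun ε hε _ => ?_) zero_le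
  rw [zero_add]
  have hε' : (0 : ℝ) < ε := hε
  obtain ⟨P₀, hP₀, hNP₀, hc⟩ := hsub 0 (ε / 4) (by positivity)
  have hfr := frequently_genCountAt_lt (c := ENNReal.ofReal (ε / 2))
    (hc.trans_lt ((ENNReal.ofReal_lt_ofReal_iff (by positivity)).2 (by linarith)))
  obtain ⟨B, hB⟩ := exists_nat_gt (2 / (ε : ℝ))
  refine liminf_le_of_frequently_le
    ((hfr.and_eventually (eventually_ge_atTop (B + 1))).mono ?_) (by isBoundedDefault)
  rintro K ⟨hlt, hK⟩
  have hK0 : K ≠ 0 := by omega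
  have hK1 : (1 : ℝ) ≤ K := by exact_mod_cast Nat.pos_of_ne_zero hK0
  obtain ⟨n, x, p, T, hx, hp, hT, hcard⟩ :=
    exists_of_genCountAt_lt (φ := φ) (fun x => hτφ ⟨x, hP₀.le x.2⟩) hK0 hlt
  let o : Fin K := ⟨0, Nat.pos_of_ne_zero hK0⟩
  have ho : p o ≠ 0 := by
    intro h
    have := hp.trace_eq o
    rw [h, map_zero, eq_comm, div_eq_zero_iff] at this
    exact hK0 (by simpa using this)
  -- the additional generator lies under one projection of the partition: it adds one block
  obtain ⟨y, hyM, hpy, hyR⟩ := exists_generating_operator hφ hτφ hgen hdiff hsub hP₀ hNP₀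
    (hp.mem o) (hp.isStarProjection o) ho
  have hx' : generatedBy (Set.range (Fin.cons y x : Fin (n + 1) → H →L[ℂ] H)) = M := by
    rw [Fin.range_cons]
    refine (generatedBy_eq_iff (Set.insert_subset hyM ?_)).2 fun R hR => ?_
    · rintro _ ⟨m, rfl⟩
      exact hP₀.le (hx ▸ mem_generatedBy (Set.mem_range_self m))
    · refine hyR R ?_ (hR (Set.mem_insert _ _))
      rw [← hx, generatedBy_le_iff]
      exact (Set.subset_insert _ _).trans hR
  let T' : Finset (Fin (n + 1) × Fin K × Fin K) :=
    insert (0, o, o) (T.map ⟨fun t => (t.1.succ, t.2), fun a b hab => by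
      obtain ⟨h1, h2⟩ := Prod.ext_iff.1 hab
      exact Prod.ext (Fin.succ_injective _ h1) h2⟩)
  have hT' : ∀ (m : Fin (n + 1)) (i j : Fin K),
      p i * (Fin.cons y x : Fin (n + 1) → H →L[ℂ] H) m * p j ≠ 0 → (m, i, j) ∈ T' := by
    intro m i j
    refine Fin.cases (fun hne => ?_) (fun m hne => ?_) m
    · rw [Fin.cons_zero, ← hpy] at hne
      have hi : i = o := by
        by_contra hi
        apply hne
        rw [← mul_assoc, ← mul_assoc, hp.orthogonal i o hi, zero_mul, zero_mul, zero_mul]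
      have hj : j = o := by
        by_contra hj
        apply hne
        rw [mul_assoc, mul_assoc _ (p o), hp.orthogonal o j (Ne.symm hj), mul_zero, mul_zero]
      rw [hi, hj]
      exact Finset.mem_insert_self _ _
    · rw [Fin.cons_succ] at hne
      exact Finset.mem_insert_of_mem
        (Finset.mem_map.2 ⟨(m, i, j), hT m i j hne, rfl⟩)
  refine (genCountAt_le hτφ hx' (hp.mono hP₀.le) hT').trans ?_
  have hKpos : (0 : ℝ) < (K : ℝ) ^ 2 := by positivity
  have h1 : (T'.card : ℝ) ≤ T.card + 1 := by
    have : T'.card ≤ T.card + 1 := (Finset.card_insert_le _ _).trans (by rw [Finset.card_map])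
    exact_mod_cast this
  have h2 : 1 ≤ (ε : ℝ) / 2 * (K : ℝ) ^ 2 := by
    have h3 : (B : ℝ) ≤ K := by exact_mod_cast (by omega : B ≤ K)
    have h4 : 2 / (ε : ℝ) ≤ K := hB.le.trans h3
    rw [div_le_iff₀ hε'] at h4
    nlinarith
  have h5 : (T'.card : ℝ) / (K : ℝ) ^ 2 ≤ ε := by
    rw [div_le_iff₀ hKpos]
    linarith
  calc (T'.card : ℝ≥0∞) / (K : ℝ≥0∞) ^ 2 = ENNReal.ofReal (T'.card / (K : ℝ) ^ 2) := by
        rw [ENNReal.ofReal_div_of_pos hKpos, ENNReal.ofReal_natCast,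
          ENNReal.ofReal_pow (by positivity), ENNReal.ofReal_natCast]
    _ ≤ ENNReal.ofReal ε := ENNReal.ofReal_le_ofReal h5
    _ = ε := ENNReal.ofReal_coe_nnreal
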